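/- Let $A$ (the system) and $B$ (its environment) be finite-dimensional quantum systems with state spaces $\mathbb C^{d_A}$, $\mathbb C^{d_B}$, and let $\rho=\rho_{AB}$ be a density matrix on $\mathbb C^{d_A}\otimes\mathbb C^{d_B}$, with $\rho_A=\mathrm{tr}_B\rho$ and $\rho_B=\mathrm{tr}_A\rho$. Let $S(\sigma)=-\mathrm{tr}(\sigma\log_2\sigma)$ be the von Neumann entropy (with $0\log 0=0$). For a complete set $\{\Pi_i\}$ of mutually orthogonal rank-one projectors on $\mathbb C^{d_A}$ put $\Pi_i^A=\Pi_i\otimes 1$, $p_i=\mathrm{tr}(\Pi_i^A\rho)$, $\rho_{B|\Pi_i}=\frac1{p_i}\Pi_i^A\rho\,\Pi_i^A$, and $$\mathcal I_{B:A}=S(\rho_B)+S(\rho_A)-S(\rho),\qquad \mathcal J_{B:A}=S(\rho_B)-\sum_i p_i\,S(\rho_{B|\Pi_i})$$ (terms with $p_i=0$ are zero). The quantum discord with measurements on $A$ is $\mathcal D_{B:A}(\rho)=\min_{\{\Pi_i\}}(\mathcal I_{B:A}-\mathcal J_{B:A})$; this minimum is attained. (a) The following are equivalent: (i) $\mathcal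 D_{B:A}(\rho)=0$; (ii) $\rho=\sum_i\Pi_i^A\rho\,\Pi_i^A$ for some complete set $\{\Pi_i\}$ of mutually orthogonal rank-one projectors on $A$; (iii) $\rho=\sum_j p_j\,\Pi_j\otimes\tau_j$ for some such set $\{\Pi_j\}$, a probability vector $(p_j)$ and density matrices $\tau_j$ on $B$; (iv) $\rho=\sum_j p_j\,\Pi_j\otimes\tau_j$ for some finite family of mutually orthogonal projectors $\Pi_j$ on $A$ (of any ranks) with $\sum_j\Pi_j=1$, numbers $p_j\ge 0$ and density matrices $\tau_j$ on $B$. (b) Suppose $\mathcal D_{B:A}(\rho)=0$, and let $\rho=\sum_j p_j\,\Pi_j\otimes\tau_j$ be any decomposition as in (iv) (in particular, any as in (iii)). Let $U$ be any unitary on the joint system and $\{|n\rangle\}$ any orthonormal basis of the space of $B$, write $|v\rangle^B=1\otimes|v\rangle$ and $\langle v|^B=(|v\rangle^B)^\dagger$, and define operators on $A$ by $$K_{nm}=\sum_l\langle n|^B\,U\,(\sqrt{\tau_l}\,|m\rangle)^B\,\Pi_l .$$ Then $\sum_{n,m}K_{nm}^\dagger K_{nm}=1$, the map $\mathcal E(X)=\sum_{n,m}K_{nm}XK_{nm}^\dagger$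 is completely positive and trace preserving, and the reduced evolution of $A$ is given by it: $$\mathrm{tr}_B(U\rho\,U^\dagger)=\mathcal E(\mathrm{tr}_B\rho).$$ Moreover the same map $\mathcal E$, which does not depend on the $p_j$, describes the reduced evolution of every state $\sigma=\sum_j q_j\,\Pi_j\otimes\tau_j$ with the same $\Pi_j$ and $\tau_j$: $\mathrm{tr}_B(U\sigma U^\dagger)=\mathcal E(\mathrm{tr}_B\sigma)$. -/

import Mathlib

/-!
Finite-dimensional quantum systems. A system whose state space is `ℂ^A` is given by a finite index
type `A` of its computational basis; the composite of `A` and `B` is indexed by `A × B`, and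
tensor products of operators are Kronecker products.
-/

open scoped Matrix Kronecker MatrixOrder ComplexOrder

namespace QDiscord

noncomputable section

variable {A B ι κ : Type*} [Fintype A] [DecidableEq A] [Fintype B] [DecidableEq B]
  [Fintype ι] [Fintype κ]

/-- Density matrices: positive semidefinite of trace one. -/
structure IsState (ρ : Matrix A A ℂ) : Prop where
  posSemidef : ρ.PosSemidef
  trace_eq_one : ρ.trace = 1

/-- The partial trace over the second system: `(tr_B ρ)_{mn} = ∑ i, ρ_{mi,ni}`. -/
def trB (ρ : Matrix (A × B) (A × B) ℂ) : Matrix A A ℂ :=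
  Matrix.of fun m n => ∑ i : B, ρ (m, i) (n, i)

/-- The partial trace over the first system. -/
def trA (ρ : Matrix (A × B) (A × B) ℂ) : Matrix B B ℂ :=
  Matrix.of fun m n => ∑ i : A, ρ (i, m) (i, n)

/-- The von Neumann entropy `-∑ λ log₂ λ` over the eigenvalues of a Hermitian matrix, with
multiplicity and with `0 log 0 = 0`. (The value on non-Hermitian matrices is irrelevant.) -/
def entropy (ρ : Matrix A A ℂ) : ℝ :=
  open Classical in
  if h : ρ.IsHermitian then ∑ i, -(h.eigenvalues i * Real.logb 2 (h.eigenvalues i)) else 0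

/-- A complete set of mutually orthogonal (self-adjoint) projectors, of arbitrary ranks. -/
structure IsProjFamily (P : ι → Matrix A A ℂ) : Prop where
  isHermitian : ∀ i, (P i).IsHermitian
  mul_self : ∀ i, P i * P i = P i
  orthogonal : ∀ i j, i ≠ j → P i * P j = 0
  complete : ∑ i, P i = 1

/-- A complete set of one-dimensional orthogonal projectors. Such a set has exactly as many
members as the dimension of the system, and is therefore indexed by `A` itself. -/
structure IsMeasurement (P : A → Matrix A A ℂ) : Prop extends IsProjFamily P where
  rank_eq_one : ∀ i, (P i).rank = 1

/-- The operator `M ⊗ 1` on the joint system. -/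
def onA (B : Type*) [DecidableEq B] (M : Matrix A A ℂ) : Matrix (A × B) (A × B) ℂ :=
  M ⊗ₖ (1 : Matrix B B ℂ)

/-- The probability `tr (Π^A ρ)` of the outcome `Π`. -/
def outcomeProb (ρ : Matrix (A × B) (A × B) ℂ) (M : Matrix A A ℂ) : ℝ :=
  (onA B M * ρ).trace.re

/-- The state `(1 / p) Π^A ρ Π^A` of the joint system after the outcome `Π`. (For an outcome of
probability zero it is the zero matrix; it is only ever used with the weight `p`.) -/
def postState (ρ : Matrix (A × B) (A × B) ℂ) (M : Matrix A A ℂ) : Matrix (A × B) (A × B) ℂ :=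
  ((outcomeProb ρ M : ℂ))⁻¹ • (onA B M * ρ * onA B M)

/-- The conditional entropy `∑ i, p_i S(ρ_{B|Π_i})` for measurements on `A`. -/
def condEntropy (ρ : Matrix (A × B) (A × B) ℂ) (P : A → Matrix A A ℂ) : ℝ :=
  ∑ i, outcomeProb ρ (P i) * entropy (postState ρ (P i))

/-- The quantum mutual information `I_{B:A} = S(ρ_B) + S(ρ_A) - S(ρ_AB)`. -/
def mutualI (ρ : Matrix (A × B) (A × B) ℂ) : ℝ :=
  entropy (trA ρ) + entropy (trB ρ) - entropy ρ

/-- The information `J_{B:A} = S(ρ_B) - S(ρ_AB | {Π_i^A})` about `B` from measuring `A`. -/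
def mutualJ (ρ : Matrix (A × B) (A × B) ℂ) (P : A → Matrix A A ℂ) : ℝ :=
  entropy (trA ρ) - condEntropy ρ P

/-- All values of `I_{B:A} - J_{B:A}`, as the measurement on `A` varies. -/
def discordValues (ρ : Matrix (A × B) (A × B) ℂ) : Set ℝ :=
  {d | ∃ P : A → Matrix A A ℂ, IsMeasurement P ∧ d = mutualI ρ - mutualJ ρ P}

/-- The quantum discord `D_{B:A}(ρ) = min (I_{B:A} - J_{B:A})`, over the measurements on `A`. -/
def discordBA (ρ : Matrix (A × B) (A × B) ℂ) : ℝ :=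
  sInf (discordValues ρ)

/-- The matrix `∑ j, p_j Π_j ⊗ τ_j`. -/
def cqMatrix (p : ι → ℝ) (P : ι → Matrix A A ℂ) (τ : ι → Matrix B B ℂ) :
    Matrix (A × B) (A × B) ℂ :=
  ∑ j, (p j : ℂ) • (P j ⊗ₖ τ j)

/-- `|v⟩^B = 1 ⊗ |v⟩`, as an operator from `A` to the joint system. -/
def ketB (A : Type*) [DecidableEq A] (v : B → ℂ) : Matrix (A × B) A ℂ :=
  Matrix.of fun x a => if x.1 = a then v x.2 else 0

/-- `⟨v|^B`, the adjoint of `|v⟩^B`. -/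
def braB (A : Type*) [DecidableEq A] (v : B → ℂ) : Matrix A (A × B) ℂ :=
  (ketB A v)ᴴ

/-- `K_{nm} = ∑ l, ⟨n|^B U (√τ_l |m⟩)^B Π_l`, for an orthonormal basis `e` of the space of `B`. -/
def krausOp (P : ι → Matrix A A ℂ) (τ : ι → Matrix B B ℂ) (U : Matrix (A × B) (A × B) ℂ)
    (e : OrthonormalBasis B ℂ (EuclideanSpace ℂ B)) (nm : B × B) : Matrix A A ℂ :=
  ∑ l, braB A (e nm.1) * U * ketB A (CFC.sqrt (τ l) *ᵥ (e nm.2)) * P l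

/-- The linear map `X ↦ ∑ k, K_k X K_k†`. -/
def krausMap (K : κ → Matrix A A ℂ) : Matrix A A ℂ →ₗ[ℂ] Matrix A A ℂ where
  toFun X := ∑ k, K k * X * (K k)ᴴ
  map_add' X Y := by simp [Matrix.mul_add, Matrix.add_mul, Finset.sum_add_distrib]
  map_smul' c X := by simp [Finset.smul_sum]

/-- The map `I ⊗ E` on the system `A` together with an auxiliary system `C`: `E` is applied to
each of the blocks of `X`. -/
def ampliation (C : Type*) (E : Matrix A A ℂ →ₗ[ℂ] Matrix A A ℂ) (X : Matrix (C × A) (C × A) ℂ) :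
    Matrix (C × A) (C × A) ℂ :=
  Matrix.of fun x y => E (Matrix.of fun a a' => X (x.1, a) (y.1, a')) x.2 y.2

/-- Completely positive trace-preserving maps: `E` preserves the trace, and `I ⊗ E` is positive
for auxiliary systems of every dimension. -/
structure IsCPTP (E : Matrix A A ℂ →ₗ[ℂ] Matrix A A ℂ) : Prop where
  trace_preserving : ∀ X, (E X).trace = X.trace
  positive : ∀ X : Matrix A A ℂ, X.PosSemidef → (E X).PosSemidef
  completely_positive : ∀ (k : ℕ) (X : Matrix (Fin k × A) (Fin k × A) ℂ),
    X.PosSemidef → (ampliation (Fin k) E X).PosSemidef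

/-- The state of `A` after the joint system in the state `ρ` has evolved under `U`. -/
def reducedEvolution (U ρ : Matrix (A × B) (A × B) ℂ) : Matrix A A ℂ :=
  trB (U * ρ * Uᴴ)

end

end QDiscord

/-!
Write `R = ρ_A ⊗ 1` and `T = ∑ i, ρ_{B|Π_i} = ∑ i, Π_i ⊗ τ_i`. Up to the factor `log 2`, the
difference `I - J = S(ρ_A) - S(ρ) + ∑ i, p_i S(ρ_{B|Π_i})` is the relative entropy of `ρ` with
respect to `exp (log R + log T)`, and `tr (R T) = 1`. Klein's inequality, together with the
Golden–Thompson inequality `tr exp (H + K) ≤ tr (exp H exp K)` sharpened by the commutator of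
`exp (H / 2)` and `exp (K / 2)`, shows that `I - J ≥ 0` and that equality forces `R` and `T` to
commute and `ρ = R T`. A joint eigenbasis of `ρ_A` and of `∑ i, f_i Π_i`, where `f` separates the
distinct `τ_i`, is then a measurement under which `ρ` is block diagonal. Singular `R` and `T` are
handled by a regularized logarithm. The minimum is attained because measurements are parametrized
by the compact unitary group and the entropy is continuous.

For the reduced evolution, `σ = ∑ m, W_m σ_A W_m†` with `W_m = ∑ l, (√τ_l |m⟩)^B Π_l` for all the
states `σ = ∑ j, q_j Π_j ⊗ τ_j` at once, so that the Kraus operators are `⟨n|^B U W_m`.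
-/

namespace QDiscord

open Filter Topology

section Trotter

variable {𝔸 : Type*} [NormedRing 𝔸] [NormOneClass 𝔸]

lemma norm_pow_sub_pow_le {x y : 𝔸} {c : ℝ} (hx : ‖x‖ ≤ c) (hy : ‖y‖ ≤ c) (hc : 1 ≤ c) (n : ℕ) :
    ‖x ^ n - y ^ n‖ ≤ n * c ^ n * ‖x - y‖ := by
  induction n with
  | zero => simp
  | succ n ih =>
    have telescope : x ^ (n + 1) - y ^ (n + 1) = x ^ n * (x - y) + (x ^ n - y ^ n) * y := by
      noncomm_ring
    have hxn : ‖x ^ n‖ ≤ c ^ (n + 1) := calc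
      ‖x ^ n‖ ≤ ‖x‖ ^ n := norm_pow_le _ _
      _ ≤ c ^ n := by gcongr
      _ ≤ c ^ (n + 1) := pow_le_pow_right₀ hc n.le_succ
    calc ‖x ^ (n + 1) - y ^ (n + 1)‖ ≤ ‖x ^ n‖ * ‖x - y‖ + ‖x ^ n - y ^ n‖ * ‖y‖ := by
          rw [telescope]
          exact norm_add_le_of_le (norm_mul_le _ _) (norm_mul_le _ _)
      _ ≤ c ^ (n + 1) * ‖x - y‖ + n * c ^ n * ‖x - y‖ * c := by gcongr
      _ = (n + 1 : ℕ) * c ^ (n + 1) * ‖x - y‖ := by push_cast; ring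

variable [NormedAlgebra ℝ 𝔸]

lemma norm_exp_le_exp_norm (x : 𝔸) : ‖NormedSpace.exp x‖ ≤ Real.exp ‖x‖ := by
  rw [NormedSpace.exp_eq_tsum ℝ, Real.exp_eq_exp_ℝ, NormedSpace.exp_eq_tsum ℝ]
  refine tsum_of_norm_bounded (NormedSpace.expSeries_summable' (𝕂 := ℝ) ‖x‖).hasSum fun n => ?_
  rw [norm_smul, Real.norm_of_nonneg (by positivity), smul_eq_mul]
  gcongr
  exact norm_pow_le x n

variable [CompleteSpace 𝔸]

omit [NormOneClass 𝔸] in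
lemma tendsto_mul_norm_exp_mul_exp_sub_exp_add (x y : 𝔸) :
    Tendsto (fun n : ℕ => n * ‖NormedSpace.exp ((n : ℝ)⁻¹ • x) * NormedSpace.exp ((n : ℝ)⁻¹ • y) -
      NormedSpace.exp ((n : ℝ)⁻¹ • (x + y))‖) atTop (𝓝 0) := by
  let f : ℝ → 𝔸 := fun t =>
    NormedSpace.exp (t • x) * NormedSpace.exp (t • y) - NormedSpace.exp (t • (x + y))
  have f_zero : f 0 = 0 := by simp [f]
  have f_deriv : HasDerivAt f 0 0 :=
    (((hasDerivAt_exp_smul_const x (0 : ℝ)).mul (hasDerivAt_exp_smul_const y (0 : ℝ))).sub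
      (hasDerivAt_exp_smul_const (x + y) (0 : ℝ))).congr_deriv (by simp)
  have inv_tendsto : Tendsto (fun n : ℕ => (n : ℝ)⁻¹) atTop (𝓝[≠] 0) := by
    refine tendsto_nhdsWithin_iff.2 ⟨tendsto_inv_atTop_nhds_zero_nat, ?_⟩
    filter_upwards [eventually_gt_atTop 0] with n hn
    simpa using hn.ne'
  simpa [Function.comp_def, f_zero, norm_smul, f] using
    (f_deriv.tendsto_slope_zero.comp inv_tendsto).norm

lemma norm_exp_mul_exp_pow_sub_exp_add_le (x y : 𝔸) {n : ℕ} (hn : n ≠ 0) :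
    ‖(NormedSpace.exp ((n : ℝ)⁻¹ • x) * NormedSpace.exp ((n : ℝ)⁻¹ • y)) ^ n -
        NormedSpace.exp (x + y)‖ ≤
      Real.exp (‖x‖ + ‖y‖) * (n * ‖NormedSpace.exp ((n : ℝ)⁻¹ • x) *
        NormedSpace.exp ((n : ℝ)⁻¹ • y) - NormedSpace.exp ((n : ℝ)⁻¹ • (x + y))‖) := by
  have hn₀ : (n : ℝ) ≠ 0 := Nat.cast_ne_zero.2 hn
  have norm_inv_smul (z : 𝔸) : ‖(n : ℝ)⁻¹ • z‖ = (n : ℝ)⁻¹ * ‖z‖ := by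
    rw [norm_smul, Real.norm_of_nonneg (by positivity)]
  have exp_root : NormedSpace.exp (x + y) = NormedSpace.exp ((n : ℝ)⁻¹ • (x + y)) ^ n := by
    let := NormedAlgebra.restrictScalars ℚ ℝ 𝔸
    rw [← NormedSpace.exp_nsmul, ← Nat.cast_smul_eq_nsmul ℝ, smul_inv_smul₀ hn₀]
  set c := Real.exp ((n : ℝ)⁻¹ * (‖x‖ + ‖y‖)) with hc
  have le_left : ‖NormedSpace.exp ((n : ℝ)⁻¹ • x) * NormedSpace.exp ((n : ℝ)⁻¹ • y)‖ ≤ c := by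
    rw [hc, mul_add, Real.exp_add, ← norm_inv_smul, ← norm_inv_smul]
    exact norm_mul_le_of_le (norm_exp_le_exp_norm _) (norm_exp_le_exp_norm _)
  have le_right : ‖NormedSpace.exp ((n : ℝ)⁻¹ • (x + y))‖ ≤ c := by
    refine (norm_exp_le_exp_norm _).trans ?_
    rw [hc, norm_inv_smul]
    gcongr
    exact norm_add_le _ _
  have c_pow : c ^ n = Real.exp (‖x‖ + ‖y‖) := by
    rw [hc, ← Real.exp_nat_mul, mul_inv_cancel_left₀ hn₀]
  rw [exp_root, ← c_pow]
  exact (norm_pow_sub_pow_le le_left le_right (Real.one_le_exp (by positivity)) n).trans_eq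
    (by ring)

lemma tendsto_exp_mul_exp_pow (x y : 𝔸) :
    Tendsto (fun n : ℕ => (NormedSpace.exp ((n : ℝ)⁻¹ • x) * NormedSpace.exp ((n : ℝ)⁻¹ • y)) ^ n)
      atTop (𝓝 (NormedSpace.exp (x + y))) := by
  have bound := (tendsto_mul_norm_exp_mul_exp_sub_exp_add x y).const_mul (Real.exp (‖x‖ + ‖y‖))
  rw [mul_zero] at bound
  rw [tendsto_iff_norm_sub_tendsto_zero]
  refine squeeze_zero' (Eventually.of_forall fun _ => norm_nonneg _) ?_ bound
  filter_upwards [eventually_ne_atTop 0] with n hn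
  exact norm_exp_mul_exp_pow_sub_exp_add_le x y hn

open scoped Matrix.Norms.L2Operator in
lemma tendsto_matrix_exp_mul_exp_pow {𝕜 n : Type*} [RCLike 𝕜] [Fintype n] [DecidableEq n]
    (H K : Matrix n n 𝕜) :
    Tendsto (fun m : ℕ => (NormedSpace.exp ((m : ℝ)⁻¹ • H) * NormedSpace.exp ((m : ℝ)⁻¹ • K)) ^ m)
      atTop (𝓝 (NormedSpace.exp (H + K))) := by
  let : NormedAlgebra ℝ (Matrix n n 𝕜) :=
    { norm_smul_le := fun r M => by
        rw [← algebraMap_smul 𝕜 r M, norm_smul, norm_algebraMap'] }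
  cases isEmpty_or_nonempty n
  · exact (tendsto_const_nhds (x := NormedSpace.exp (H + K))).congr fun _ => Subsingleton.elim _ _
  · exact tendsto_exp_mul_exp_pow H K

end Trotter

section TraceInequalities

variable {𝕜 n : Type*} [RCLike 𝕜] [Fintype n]

open scoped Matrix.Norms.Frobenius

lemma frobenius_norm_sq {m : Type*} [Fintype m] (X : Matrix m n 𝕜) :
    ‖X‖ ^ 2 = ∑ i, ∑ j, ‖X i j‖ ^ 2 := by
  rw [Matrix.frobenius_norm_def, ← Real.rpow_mul_natCast (by positivity)]
  norm_num

lemma re_trace_mul_conjTranspose {m : Type*} [Fintype m] (X : Matrix m n 𝕜) :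
    RCLike.re (X * Xᴴ).trace = ‖X‖ ^ 2 := by
  rw [frobenius_norm_sq, ← RCLike.ofReal_re (K := 𝕜) (∑ i, ∑ j, ‖X i j‖ ^ 2)]
  simp [Matrix.trace, Matrix.mul_apply, RCLike.mul_conj]

lemma norm_trace_mul_le {m : Type*} [Fintype m] (X : Matrix m n 𝕜) (Y : Matrix n m 𝕜) :
    ‖(X * Y).trace‖ ≤ ‖X‖ * ‖Y‖ := by
  rw [← Matrix.frobenius_norm_transpose Y, ← Real.sqrt_sq (norm_nonneg X),
    ← Real.sqrt_sq (norm_nonneg Yᵀ), frobenius_norm_sq, frobenius_norm_sq]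
  simp only [Matrix.trace, Matrix.diag_apply, Matrix.mul_apply, ← Finset.sum_product',
    Matrix.transpose_apply]
  refine (norm_sum_le _ _).trans ?_
  simp only [norm_mul]
  exact Real.sum_mul_le_sqrt_mul_sqrt _ _ _

lemma re_trace_mul_sq {M N : Matrix n n 𝕜} (hM : M.IsHermitian) (hN : N.IsHermitian) :
    RCLike.re (M * N * (M * N)).trace =
      RCLike.re (M * M * (N * N)).trace - ‖M * N - N * M‖ ^ 2 / 2 := by
  have expand : (M * N - N * M) * (M * N - N * M)ᴴ =
      M * (N * N * M) - M * N * (M * N) - N * (M * N * M) + N * (M * M * N) := by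
    rw [Matrix.conjTranspose_sub, Matrix.conjTranspose_mul, Matrix.conjTranspose_mul, hM.eq, hN.eq]
    noncomm_ring
  have square₁ : (M * (N * N * M)).trace = (M * M * (N * N)).trace := by
    rw [Matrix.trace_mul_comm, mul_assoc, Matrix.trace_mul_comm]
  have square₂ : (N * (M * M * N)).trace = (M * M * (N * N)).trace := by
    rw [Matrix.trace_mul_comm, mul_assoc]
  have cross : (N * (M * N * M)).trace = (M * N * (M * N)).trace := by
    rw [Matrix.trace_mul_comm]; simp only [mul_assoc]
  rw [← re_trace_mul_conjTranspose, expand, Matrix.trace_add, Matrix.trace_sub, Matrix.trace_sub,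
    square₁, square₂, cross]
  simp only [map_add, map_sub]
  ring

variable [DecidableEq n]

lemma trace_mul_pow_comm {R m : Type*} [CommSemiring R] [Fintype m] [DecidableEq m]
    (X Y : Matrix m m R) (k : ℕ) : ((X * Y) ^ k).trace = ((Y * X) ^ k).trace := by
  cases k with
  | zero => simp
  | succ k => rw [pow_succ', mul_assoc, Matrix.trace_mul_comm, mul_assoc, mul_pow_mul, ← mul_assoc,
      ← pow_succ']

lemma trace_mul_mul_conjTranspose_pow (X Y : Matrix n n 𝕜) (k : ℕ) :
    ((X * Y * (X * Y)ᴴ) ^ k).trace = ((Xᴴ * X * (Y * Yᴴ)) ^ k).trace := by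
  rw [Matrix.conjTranspose_mul, mul_assoc, trace_mul_pow_comm X]
  simp only [mul_assoc]
  rw [← mul_assoc, trace_mul_pow_comm, mul_assoc]

lemma norm_trace_two_pow_le_and_norm_trace_mul_two_pow_le (k : ℕ) :
    (∀ X : Matrix n n 𝕜, ‖(X ^ 2 ^ (k + 1)).trace‖ ≤ RCLike.re ((X * Xᴴ) ^ 2 ^ k).trace) ∧
    ∀ P Q : Matrix n n 𝕜, P.IsHermitian → Q.IsHermitian →
      ‖((P * Q) ^ 2 ^ k).trace‖ ≤
        (RCLike.re (P ^ 2 ^ (k + 1)).trace + RCLike.re (Q ^ 2 ^ (k + 1)).trace) / 2 := by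
  induction k with
  | zero =>
    refine ⟨fun X => ?_, fun P Q hP hQ => ?_⟩
    · simpa [pow_two, re_trace_mul_conjTranspose] using norm_trace_mul_le X X
    · have hP₂ := re_trace_mul_conjTranspose P
      have hQ₂ := re_trace_mul_conjTranspose Q
      rw [hP.eq] at hP₂
      rw [hQ.eq] at hQ₂
      simp only [zero_add, pow_one, pow_zero, pow_two, hP₂, hQ₂]
      linarith [norm_trace_mul_le P Q, two_mul_le_add_sq ‖P‖ ‖Q‖]
  | succ k ih =>
    obtain ⟨trace_pow_le, trace_mul_pow_le⟩ := ih
    refine ⟨fun X => ?_, fun P Q hP hQ => ?_⟩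
    · have h := trace_mul_pow_le (Xᴴ * X) (X * Xᴴ) (Matrix.isHermitian_conjTranspose_mul_self X)
        (Matrix.isHermitian_mul_conjTranspose_self X)
      rw [trace_mul_pow_comm Xᴴ X, add_self_div_two] at h
      calc ‖(X ^ 2 ^ (k + 1 + 1)).trace‖ = ‖((X * X) ^ 2 ^ (k + 1)).trace‖ := by
            rw [← pow_two, ← pow_mul, ← pow_succ']
        _ ≤ RCLike.re ((Xᴴ * X * (X * Xᴴ)) ^ 2 ^ k).trace := by
            rw [← trace_mul_mul_conjTranspose_pow]
            exact trace_pow_le (X * X)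
        _ ≤ _ := (RCLike.re_le_norm _).trans h
    · have h := trace_mul_pow_le (P ^ 2) (Q ^ 2) (hP.pow 2) (hQ.pow 2)
      rw [← pow_mul, ← pow_mul, ← pow_succ'] at h
      refine ((trace_pow_le (P * Q)).trans_eq ?_).trans ((RCLike.re_le_norm _).trans h)
      rw [trace_mul_mul_conjTranspose_pow, hP.eq, hQ.eq, pow_two, pow_two]

lemma re_trace_mul_pow_two_pow_le {P Q : Matrix n n 𝕜} (hP : P.IsHermitian) (hQ : Q.IsHermitian)
    (k : ℕ) :
    RCLike.re ((P * Q) ^ 2 ^ (k + 1)).trace ≤ RCLike.re ((P ^ 2 * Q ^ 2) ^ 2 ^ k).trace := by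
  have h := (RCLike.re_le_norm _).trans
    ((norm_trace_two_pow_le_and_norm_trace_mul_two_pow_le k).1 (P * Q))
  rwa [trace_mul_mul_conjTranspose_pow, hP.eq, hQ.eq, ← pow_two, ← pow_two] at h

lemma isHermitian_exp_smul {M : Matrix n n 𝕜} (hM : M.IsHermitian) (r : ℝ) :
    (NormedSpace.exp (r • M)).IsHermitian :=
  (hM.smul (IsSelfAdjoint.all r)).exp

lemma exp_half_mul_self (M : Matrix n n 𝕜) :
    NormedSpace.exp ((2 : ℝ)⁻¹ • M) * NormedSpace.exp ((2 : ℝ)⁻¹ • M) = NormedSpace.exp M := by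
  rw [← Matrix.exp_add_of_commute _ _ (Commute.refl _), ← add_smul, ← two_mul,
    mul_inv_cancel₀ two_ne_zero, one_smul]

lemma antitone_re_trace_exp_mul_exp_pow {H K : Matrix n n 𝕜} (hH : H.IsHermitian)
    (hK : K.IsHermitian) :
    Antitone fun k : ℕ => RCLike.re ((NormedSpace.exp (((2 ^ k : ℕ) : ℝ)⁻¹ • H) *
      NormedSpace.exp (((2 ^ k : ℕ) : ℝ)⁻¹ • K)) ^ 2 ^ k).trace := by
  have exp_sq (k : ℕ) (M : Matrix n n 𝕜) :
      NormedSpace.exp (((2 ^ (k + 1) : ℕ) : ℝ)⁻¹ • M) ^ 2 =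
        NormedSpace.exp (((2 ^ k : ℕ) : ℝ)⁻¹ • M) := by
    rw [← Matrix.exp_nsmul, ← Nat.cast_smul_eq_nsmul ℝ, smul_smul]
    congr 2
    push_cast
    rw [pow_succ]
    field_simp
  refine antitone_nat_of_succ_le fun k => ?_
  have h := re_trace_mul_pow_two_pow_le (isHermitian_exp_smul hH (((2 ^ (k + 1) : ℕ) : ℝ)⁻¹))
    (isHermitian_exp_smul hK (((2 ^ (k + 1) : ℕ) : ℝ)⁻¹)) k
  rwa [exp_sq, exp_sq] at h

lemma re_trace_exp_add_le {H K : Matrix n n 𝕜} (hH : H.IsHermitian) (hK : K.IsHermitian) :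
    RCLike.re (NormedSpace.exp (H + K)).trace ≤
      RCLike.re (NormedSpace.exp H * NormedSpace.exp K).trace -
        ‖NormedSpace.exp ((2 : ℝ)⁻¹ • H) * NormedSpace.exp ((2 : ℝ)⁻¹ • K) -
          NormedSpace.exp ((2 : ℝ)⁻¹ • K) * NormedSpace.exp ((2 : ℝ)⁻¹ • H)‖ ^ 2 / 2 := by
  have trotter : Tendsto (fun k : ℕ => RCLike.re ((NormedSpace.exp (((2 ^ k : ℕ) : ℝ)⁻¹ • H) *
      NormedSpace.exp (((2 ^ k : ℕ) : ℝ)⁻¹ • K)) ^ 2 ^ k).trace) atTop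
      (𝓝 (RCLike.re (NormedSpace.exp (H + K)).trace)) :=
    (((RCLike.continuous_re.comp continuous_id.matrix_trace).tendsto _).comp
      (tendsto_matrix_exp_mul_exp_pow H K)).comp (tendsto_pow_atTop_atTop_of_one_lt one_lt_two)
  have h := (antitone_re_trace_exp_mul_exp_pow hH hK).le_of_tendsto trotter 1
  rw [pow_one, Nat.cast_two, pow_two, re_trace_mul_sq (isHermitian_exp_smul hH _)
    (isHermitian_exp_smul hK _), exp_half_mul_self,
    exp_half_mul_self] at h
  exact h

end TraceInequalities

section FunctionalCalculus

variable {𝕜 n : Type*} [RCLike 𝕜] [Fintype n] [DecidableEq n]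

lemma cfc_eq_conj_diagonal {M : Matrix n n 𝕜} (hM : M.IsHermitian) (f : ℝ → ℝ) :
    cfc f M = (hM.eigenvectorUnitary : Matrix n n 𝕜) *
      Matrix.diagonal (fun i => (f (hM.eigenvalues i) : 𝕜)) *
      (hM.eigenvectorUnitary : Matrix n n 𝕜)ᴴ := by
  rw [hM.cfc_eq, Matrix.IsHermitian.cfc, Unitary.conjStarAlgAut_apply]
  rfl

lemma isHermitian_cfc (f : ℝ → ℝ) (M : Matrix n n 𝕜) : (cfc f M).IsHermitian :=
  cfc_predicate f M

lemma continuousOn_spectrum (f : ℝ → ℝ) (M : Matrix n n 𝕜) : ContinuousOn f (spectrum ℝ M) :=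
  Matrix.finite_real_spectrum.continuousOn f

lemma trace_cfc {M : Matrix n n 𝕜} (hM : M.IsHermitian) (f : ℝ → ℝ) :
    (cfc f M).trace = ∑ i, (f (hM.eigenvalues i) : 𝕜) := by
  have unitary : (hM.eigenvectorUnitary : Matrix n n 𝕜)ᴴ * hM.eigenvectorUnitary = 1 :=
    Unitary.coe_star_mul_self hM.eigenvectorUnitary
  rw [cfc_eq_conj_diagonal hM, Matrix.trace_mul_comm, ← mul_assoc, unitary, one_mul,
    Matrix.trace_diagonal]

lemma re_trace_cfc_mul_cfc {M N : Matrix n n 𝕜} (hM : M.IsHermitian) (hN : N.IsHermitian)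
    (f g : ℝ → ℝ) :
    RCLike.re (cfc f M * cfc g N).trace =
      ∑ i, ∑ j, ‖((hM.eigenvectorUnitary : Matrix n n 𝕜)ᴴ * hN.eigenvectorUnitary) i j‖ ^ 2 *
        (f (hM.eigenvalues i) * g (hN.eigenvalues j)) := by
  set U := (hM.eigenvectorUnitary : Matrix n n 𝕜)
  set V := (hN.eigenvectorUnitary : Matrix n n 𝕜)
  set F : Matrix n n 𝕜 := Matrix.diagonal fun i => (f (hM.eigenvalues i) : 𝕜) with hF
  set G : Matrix n n 𝕜 := Matrix.diagonal fun j => (g (hN.eigenvalues j) : 𝕜) with hG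
  have cyclic : (U * F * Uᴴ * (V * G * Vᴴ)).trace = (F * (Uᴴ * V) * (G * (Uᴴ * V)ᴴ)).trace := by
    rw [Matrix.conjTranspose_mul, Matrix.conjTranspose_conjTranspose, mul_assoc, mul_assoc,
      Matrix.trace_mul_comm]
    simp only [mul_assoc]
  rw [cfc_eq_conj_diagonal hM, cfc_eq_conj_diagonal hN, cyclic, Matrix.trace, map_sum]
  refine Finset.sum_congr rfl fun i _ => ?_
  rw [Matrix.diag_apply, Matrix.mul_apply, map_sum]
  refine Finset.sum_congr rfl fun j _ => ?_
  rw [hF, hG, Matrix.diagonal_mul, Matrix.diagonal_mul, Matrix.conjTranspose_apply,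
    mul_mul_mul_comm, RCLike.star_def, RCLike.mul_conj, mul_comm]
  norm_cast

lemma exp_smul_cfc {M : Matrix n n 𝕜} (hM : M.IsHermitian) (f : ℝ → ℝ) (r : ℝ) :
    NormedSpace.exp (r • cfc f M) = cfc (fun x => Real.exp (r * f x)) M := by
  have isUnit : IsUnit (hM.eigenvectorUnitary : Matrix n n 𝕜) :=
    (Unitary.toUnits hM.eigenvectorUnitary).isUnit
  have inv : (hM.eigenvectorUnitary : Matrix n n 𝕜)ᴴ = (hM.eigenvectorUnitary : Matrix n n 𝕜)⁻¹ :=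
    (Matrix.inv_eq_left_inv (Unitary.coe_star_mul_self hM.eigenvectorUnitary)).symm
  rw [cfc_eq_conj_diagonal hM, cfc_eq_conj_diagonal hM, inv, ← smul_mul_assoc, ← mul_smul_comm,
    Matrix.exp_conj _ _ isUnit, ← Matrix.diagonal_smul, Matrix.exp_diagonal]
  congr 3
  ext i
  rw [Pi.coe_exp, Real.exp_eq_exp_ℝ]
  simpa [RCLike.real_smul_eq_coe_mul] using
    (NormedSpace.algebraMap_exp_comm (𝔸 := 𝕜) (r * f (hM.eigenvalues i))).symm

lemma exp_smul_eq_cfc {M : Matrix n n 𝕜} (hM : M.IsHermitian) (r : ℝ) :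
    NormedSpace.exp (r • M) = cfc (fun x => Real.exp (r * x)) M := by
  simpa [cfc_id ℝ M hM.isSelfAdjoint] using exp_smul_cfc hM id r

lemma cfc_mul_cfc (f g : ℝ → ℝ) (M : Matrix n n 𝕜) :
    cfc f M * cfc g M = cfc (fun x => f x * g x) M :=
  (cfc_mul f g M (continuousOn_spectrum f M) (continuousOn_spectrum g M)).symm

lemma mul_cfc {M : Matrix n n 𝕜} (hM : M.IsHermitian) (f : ℝ → ℝ) :
    M * cfc f M = cfc (fun x => x * f x) M := by
  simpa [cfc_id ℝ M hM.isSelfAdjoint] using cfc_mul_cfc id f M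

lemma cfc_sqrt_mul_self {M : Matrix n n 𝕜} (hM : M.PosSemidef) :
    cfc Real.sqrt M * cfc Real.sqrt M = M := by
  rw [cfc_mul_cfc]
  exact (cfc_congr fun x hx => Real.mul_self_sqrt (spectrum_nonneg_of_nonneg hM.nonneg hx)).trans
    (cfc_id' ℝ M hM.isHermitian.isSelfAdjoint)

lemma exists_polynomial_eval_eq {s : Set ℝ} (hs : s.Finite) (f : ℝ → ℝ) :
    ∃ q : Polynomial ℝ, ∀ x ∈ s, q.eval x = f x :=
  ⟨Lagrange.interpolate hs.toFinset id f, fun _ hx =>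
    Lagrange.eval_interpolate_at_node f (Set.injOn_id _) (hs.mem_toFinset.2 hx)⟩

lemma aeval_eq_cfc {M : Matrix n n 𝕜} (hM : M.IsHermitian) {f : ℝ → ℝ} {q : Polynomial ℝ}
    (hq : ∀ x ∈ spectrum ℝ M, q.eval x = f x) : Polynomial.aeval M q = cfc f M := by
  rw [← cfc_polynomial q M hM.isSelfAdjoint]
  exact cfc_congr hq

end FunctionalCalculus

section RelativeEntropy

variable {𝕜 n : Type*} [RCLike 𝕜] [Fintype n] [DecidableEq n]

open scoped Matrix.Norms.Frobenius

lemma norm_sub_sq_eq {M N : Matrix n n 𝕜} (hM : M.IsHermitian) (hN : N.IsHermitian) :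
    ‖M - N‖ ^ 2 =
      RCLike.re (M * M).trace - 2 * RCLike.re (M * N).trace + RCLike.re (N * N).trace := by
  rw [← re_trace_mul_conjTranspose, Matrix.conjTranspose_sub, hM.eq, hN.eq, sub_mul, mul_sub,
    mul_sub, Matrix.trace_sub, Matrix.trace_sub, Matrix.trace_sub, Matrix.trace_mul_comm N M]
  simp only [map_sub]
  ring

lemma two_mul_sub_sqrt_mul_exp_le {r : ℝ} (hr : 0 ≤ r) (x : ℝ) :
    2 * (r - √r * Real.exp (2⁻¹ * x)) ≤ r * Real.log r - r * x := by
  rcases hr.eq_or_lt with rfl | hr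
  · simp
  have hs : 0 < √r := Real.sqrt_pos.2 hr
  have log_le := Real.log_le_sub_one_of_pos (div_pos (Real.exp_pos (2⁻¹ * x)) hs)
  rw [Real.log_div (Real.exp_pos _).ne' hs.ne', Real.log_exp, Real.log_sqrt hr.le] at log_le
  have mul_div : r * (Real.exp (2⁻¹ * x) / √r) = √r * Real.exp (2⁻¹ * x) := by
    nth_rewrite 1 [← Real.mul_self_sqrt hr.le]
    field_simp
  nlinarith [mul_le_mul_of_nonneg_left log_le hr.le]

lemma two_mul_trace_sub_sqrt_mul_exp_le {ρ X : Matrix n n 𝕜} (hρ : ρ.PosSemidef)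
    (hX : X.IsHermitian) :
    2 * (RCLike.re ρ.trace -
        RCLike.re (cfc Real.sqrt ρ * NormedSpace.exp ((2 : ℝ)⁻¹ • X)).trace) ≤
      RCLike.re (ρ * cfc Real.log ρ).trace - RCLike.re (ρ * X).trace := by
  have expansion := re_trace_cfc_mul_cfc hρ.isHermitian hX
  have trace_log := expansion (fun x => x * Real.log x) 1
  have trace_mul := expansion id id
  have trace_ρ := expansion id 1
  have trace_sqrt := expansion Real.sqrt fun x => Real.exp (2⁻¹ * x)
  rw [cfc_one ℝ X hX.isSelfAdjoint, mul_one] at trace_log trace_ρ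
  rw [cfc_id ℝ ρ hρ.isHermitian.isSelfAdjoint] at trace_ρ trace_mul
  rw [cfc_id ℝ X hX.isSelfAdjoint] at trace_mul
  rw [exp_smul_eq_cfc hX, mul_cfc hρ.isHermitian, trace_log, trace_mul, trace_ρ, trace_sqrt]
  simp only [Finset.mul_sum, ← Finset.sum_sub_distrib, ← mul_sub]
  refine Finset.sum_le_sum fun i _ => Finset.sum_le_sum fun j _ => ?_
  rw [mul_left_comm]
  refine mul_le_mul_of_nonneg_left ?_ (sq_nonneg _)
  simpa using two_mul_sub_sqrt_mul_exp_le (hρ.eigenvalues_nonneg i) (hX.eigenvalues j)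

lemma klein_inequality {ρ X : Matrix n n 𝕜} (hρ : ρ.PosSemidef) (hX : X.IsHermitian) :
    RCLike.re ρ.trace - RCLike.re (NormedSpace.exp X).trace +
        ‖cfc Real.sqrt ρ - NormedSpace.exp ((2 : ℝ)⁻¹ • X)‖ ^ 2 ≤
      RCLike.re (ρ * cfc Real.log ρ).trace - RCLike.re (ρ * X).trace := by
  rw [norm_sub_sq_eq (isHermitian_cfc _ _) (isHermitian_exp_smul hX _), cfc_sqrt_mul_self hρ,
    exp_half_mul_self]
  linarith [two_mul_trace_sub_sqrt_mul_exp_le hρ hX]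

lemma klein_golden_thompson {ρ H K : Matrix n n 𝕜} (hρ : ρ.PosSemidef) (hH : H.IsHermitian)
    (hK : K.IsHermitian) :
    RCLike.re ρ.trace - RCLike.re (NormedSpace.exp H * NormedSpace.exp K).trace +
        ‖NormedSpace.exp ((2 : ℝ)⁻¹ • H) * NormedSpace.exp ((2 : ℝ)⁻¹ • K) -
          NormedSpace.exp ((2 : ℝ)⁻¹ • K) * NormedSpace.exp ((2 : ℝ)⁻¹ • H)‖ ^ 2 / 2 +
        ‖cfc Real.sqrt ρ - NormedSpace.exp ((2 : ℝ)⁻¹ • (H + K))‖ ^ 2 ≤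
      RCLike.re (ρ * cfc Real.log ρ).trace - RCLike.re (ρ * H).trace -
        RCLike.re (ρ * K).trace := by
  have klein := klein_inequality hρ (hH.add hK)
  rw [mul_add, Matrix.trace_add, map_add] at klein
  linarith [re_trace_exp_add_le hH hK]

/-- The orthogonal projection onto the kernel of a Hermitian matrix `M`. -/
noncomputable def kerProj (M : Matrix n n 𝕜) : Matrix n n 𝕜 :=
  cfc (fun x : ℝ => if x = 0 then 1 else 0 : ℝ → ℝ) M

lemma mul_kerProj {M : Matrix n n 𝕜} (hM : M.IsHermitian) : M * kerProj M = 0 := by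
  rw [kerProj, mul_cfc hM, ← cfc_const_zero ℝ M]
  exact cfc_congr fun x _ => by simp

/-- The logarithm of a positive semidefinite matrix `M`, with the value `2 log δ` in place of the
junk value `log 0 = 0` on the kernel of `M`. -/
noncomputable def regLog (δ : ℝ) (M : Matrix n n 𝕜) : Matrix n n 𝕜 :=
  cfc Real.log M + (2 * Real.log δ) • kerProj M

/-- The square root of `exp (regLog δ M)`. In contrast to `regLog δ M`, it is continuous in `δ`
at `δ = 0`, where it is the square root of `M`. -/
noncomputable def regSqrt (δ : ℝ) (M : Matrix n n 𝕜) : Matrix n n 𝕜 :=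
  cfc Real.sqrt M + δ • kerProj M

lemma isHermitian_regLog (δ : ℝ) (M : Matrix n n 𝕜) : (regLog δ M).IsHermitian :=
  (isHermitian_cfc _ _).add ((isHermitian_cfc _ _).smul (IsSelfAdjoint.all _))

lemma regLog_eq_cfc (δ : ℝ) (M : Matrix n n 𝕜) :
    regLog δ M = cfc (fun x => Real.log x + 2 * Real.log δ * if x = 0 then 1 else 0) M := by
  rw [regLog, kerProj, ← cfc_const_mul _ _ M (continuousOn_spectrum _ _),
    ← cfc_add _ _ _ (continuousOn_spectrum _ _) (continuousOn_spectrum _ _)]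

lemma regSqrt_eq_cfc (δ : ℝ) (M : Matrix n n 𝕜) :
    regSqrt δ M = cfc (fun x => √x + δ * if x = 0 then 1 else 0) M := by
  rw [regSqrt, kerProj, ← cfc_const_mul _ _ M (continuousOn_spectrum _ _),
    ← cfc_add _ _ _ (continuousOn_spectrum _ _) (continuousOn_spectrum _ _)]

lemma exp_half_regLog {M : Matrix n n 𝕜} (hM : M.PosSemidef) {δ : ℝ} (hδ : 0 < δ) :
    NormedSpace.exp ((2 : ℝ)⁻¹ • regLog δ M) = regSqrt δ M := by
  rw [regLog_eq_cfc, regSqrt_eq_cfc, exp_smul_cfc hM.isHermitian]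
  refine cfc_congr fun x hx => ?_
  obtain rfl | h_pos := (spectrum_nonneg_of_nonneg hM.nonneg hx).eq_or_lt
  · simp [Real.exp_log hδ]
  · simp [h_pos.ne', Real.sqrt_eq_rpow, Real.rpow_def_of_pos h_pos, mul_comm]

lemma regSqrt_zero (M : Matrix n n 𝕜) : regSqrt 0 M = cfc Real.sqrt M := by
  simp [regSqrt]

lemma continuous_regSqrt (M : Matrix n n 𝕜) : Continuous fun δ => regSqrt δ M := by
  unfold regSqrt
  fun_prop

/-- The relative entropy `tr ρ (log ρ - (log R + log T))` of `ρ` with respect to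
`exp (log R + log T)`, the noncommutative substitute for the product `R T`. As `log 0 = 0`, the
value is meaningful only if `ρ` vanishes on the kernels of `R` and `T`. -/
noncomputable def productRelEntropy (ρ R T : Matrix n n 𝕜) : ℝ :=
  RCLike.re (ρ * cfc Real.log ρ).trace - RCLike.re (ρ * cfc Real.log R).trace -
    RCLike.re (ρ * cfc Real.log T).trace

lemma trace_mul_regLog {ρ M : Matrix n n 𝕜} (hM : (ρ * kerProj M).trace = 0) (δ : ℝ) :
    (ρ * regLog δ M).trace = (ρ * cfc Real.log M).trace := by
  rw [regLog, mul_add, mul_smul_comm, Matrix.trace_add, Matrix.trace_smul, hM, smul_zero, add_zero]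

variable {ρ R T : Matrix n n 𝕜} (hρ : ρ.PosSemidef) (hR : R.PosSemidef) (hT : T.PosSemidef)
  (hρR : (ρ * kerProj R).trace = 0) (hρT : (ρ * kerProj T).trace = 0)

include hρ hR hT hρR hρT

lemma regularized_le_productRelEntropy {δ : ℝ} (hδ : 0 < δ) :
    RCLike.re ρ.trace -
        RCLike.re (regSqrt δ R * regSqrt δ R * (regSqrt δ T * regSqrt δ T)).trace +
        ‖regSqrt δ R * regSqrt δ T - regSqrt δ T * regSqrt δ R‖ ^ 2 / 2 +
        ‖cfc Real.sqrt ρ - NormedSpace.exp ((2 : ℝ)⁻¹ • (regLog δ R + regLog δ T))‖ ^ 2 ≤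
      productRelEntropy ρ R T := by
  have h := klein_golden_thompson hρ (isHermitian_regLog δ R) (isHermitian_regLog δ T)
  rwa [← exp_half_mul_self (regLog δ R), ← exp_half_mul_self (regLog δ T), exp_half_regLog hR hδ,
    exp_half_regLog hT hδ, trace_mul_regLog hρR, trace_mul_regLog hρT] at h

omit [DecidableEq n] [Fintype n] hρ hR hT hρR hρT in
lemma le_of_continuous_of_forall_pos {F : ℝ → ℝ} (hF : Continuous F) {c : ℝ}
    (h : ∀ δ, 0 < δ → F δ ≤ c) : F 0 ≤ c :=
  le_of_tendsto (hF.continuousWithinAt (s := Set.Ioi 0)) (eventually_mem_nhdsWithin.mono h)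

lemma norm_commutator_sq_le_productRelEntropy :
    RCLike.re ρ.trace - RCLike.re (R * T).trace +
        ‖cfc Real.sqrt R * cfc Real.sqrt T - cfc Real.sqrt T * cfc Real.sqrt R‖ ^ 2 / 2 ≤
      productRelEntropy ρ R T := by
  have contR := continuous_regSqrt R
  have contT := continuous_regSqrt T
  have h := le_of_continuous_of_forall_pos (F := fun δ => RCLike.re ρ.trace -
    RCLike.re (regSqrt δ R * regSqrt δ R * (regSqrt δ T * regSqrt δ T)).trace +
      ‖regSqrt δ R * regSqrt δ T - regSqrt δ T * regSqrt δ R‖ ^ 2 / 2) (by fun_prop)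
    fun δ hδ => (le_add_of_nonneg_right (sq_nonneg _)).trans
      (regularized_le_productRelEntropy hρ hR hT hρR hρT hδ)
  simpa only [regSqrt_zero, cfc_sqrt_mul_self hR, cfc_sqrt_mul_self hT] using h

lemma norm_sqrt_sub_sq_le_productRelEntropy (hRT : Commute R T) :
    RCLike.re ρ.trace - RCLike.re (R * T).trace +
        ‖cfc Real.sqrt ρ - cfc Real.sqrt R * cfc Real.sqrt T‖ ^ 2 ≤
      productRelEntropy ρ R T := by
  have contR := continuous_regSqrt R
  have contT := continuous_regSqrt T
  have comm (f g : ℝ → ℝ) : Commute (cfc f R) (cfc g T) :=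
    ((hRT.cfc_real f).symm.cfc_real g).symm
  have h := le_of_continuous_of_forall_pos (F := fun δ => RCLike.re ρ.trace -
    RCLike.re (regSqrt δ R * regSqrt δ R * (regSqrt δ T * regSqrt δ T)).trace +
      ‖cfc Real.sqrt ρ - regSqrt δ R * regSqrt δ T‖ ^ 2) (by fun_prop) fun δ hδ => by
    have logs_comm : Commute (regLog δ R) (regLog δ T) := by
      rw [regLog_eq_cfc, regLog_eq_cfc]
      exact comm _ _
    have bound := regularized_le_productRelEntropy hρ hR hT hρR hρT hδ
    rw [smul_add, Matrix.exp_add_of_commute _ _ ((logs_comm.smul_left _).smul_right _),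
      exp_half_regLog hR hδ, exp_half_regLog hT hδ] at bound
    linarith [sq_nonneg ‖regSqrt δ R * regSqrt δ T - regSqrt δ T * regSqrt δ R‖]
  simpa only [regSqrt_zero, cfc_sqrt_mul_self hR, cfc_sqrt_mul_self hT] using h

variable (hRT : (R * T).trace = ρ.trace)

include hRT

lemma productRelEntropy_nonneg : 0 ≤ productRelEntropy ρ R T := by
  have h := norm_commutator_sq_le_productRelEntropy hρ hR hT hρR hρT
  rw [hRT, sub_self, zero_add] at h
  exact (by positivity : (0 : ℝ) ≤ _).trans h

lemma commute_and_eq_mul_of_productRelEntropy_eq_zero (h₀ : productRelEntropy ρ R T = 0) :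
    Commute R T ∧ ρ = R * T := by
  have sqrt_comm : Commute (cfc Real.sqrt R) (cfc Real.sqrt T) := by
    have h := norm_commutator_sq_le_productRelEntropy hρ hR hT hρR hρT
    rw [hRT, sub_self, zero_add, h₀] at h
    exact sub_eq_zero.1 (norm_eq_zero.1 (pow_eq_zero_iff two_ne_zero |>.1
      (le_antisymm (by linarith) (sq_nonneg _))))
  have comm : Commute R T := by
    rw [← cfc_sqrt_mul_self hR, ← cfc_sqrt_mul_self hT]
    exact (sqrt_comm.mul_left sqrt_comm).mul_right (sqrt_comm.mul_left sqrt_comm)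
  have sqrt_eq : cfc Real.sqrt ρ = cfc Real.sqrt R * cfc Real.sqrt T := by
    have h := norm_sqrt_sub_sq_le_productRelEntropy hρ hR hT hρR hρT comm
    rw [hRT, sub_self, zero_add, h₀] at h
    exact sub_eq_zero.1 (norm_eq_zero.1 (pow_eq_zero_iff two_ne_zero |>.1
      (le_antisymm h (sq_nonneg _))))
  refine ⟨comm, ?_⟩
  calc ρ = cfc Real.sqrt R * cfc Real.sqrt T * (cfc Real.sqrt R * cfc Real.sqrt T) := by
        rw [← sqrt_eq, cfc_sqrt_mul_self hρ]
    _ = R * T := by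
        rw [sqrt_comm.symm.mul_mul_mul_comm, cfc_sqrt_mul_self hR, cfc_sqrt_mul_self hT]

end RelativeEntropy

section ProjFamilies

variable {A B ι : Type*} [DecidableEq B] [Fintype ι]

lemma isHermitian_sum {R n : Type*} [AddCommMonoid R] [StarAddMonoid R] {M : ι → Matrix n n R}
    (hM : ∀ i, (M i).IsHermitian) : (∑ i, M i).IsHermitian :=
  isSelfAdjoint_sum _ fun i _ => hM i

lemma isHermitian_onA {M : Matrix A A ℂ} (hM : M.IsHermitian) : (onA B M).IsHermitian := by
  rw [Matrix.IsHermitian, onA, Matrix.conjTranspose_kronecker, hM.eq, Matrix.conjTranspose_one]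

lemma onA_sum (M : ι → Matrix A A ℂ) : onA B (∑ i, M i) = ∑ i, onA B (M i) := by
  ext x y
  simp [onA, Matrix.sum_apply, Finset.sum_mul]

lemma continuous_onA : Continuous (onA B : Matrix A A ℂ → Matrix (A × B) (A × B) ℂ) :=
  continuous_matrix fun x y => (continuous_id.matrix_elem x.1 y.1).mul continuous_const

lemma onA_one [DecidableEq A] : onA B (1 : Matrix A A ℂ) = 1 := Matrix.one_kronecker_one

variable [Fintype A] [Fintype B]

lemma onA_mul (M N : Matrix A A ℂ) : onA B (M * N) = onA B M * onA B N := by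
  rw [onA, onA, onA, ← Matrix.mul_kronecker_mul, one_mul]

lemma commute_onA_iff {X : Matrix A A ℂ} {T : Matrix (A × B) (A × B) ℂ} :
    Commute (onA B X) T ↔ ∀ b b', Commute X (T.submatrix (·, b) (·, b')) := by
  have hleft (a a' : A) (b b' : B) :
      (onA B X * T) (a, b) (a', b') = (X * T.submatrix (·, b) (·, b')) a a' := by
    simp [onA, Matrix.mul_apply, Fintype.sum_prod_type, Matrix.one_apply]
  have hright (a a' : A) (b b' : B) :
      (T * onA B X) (a, b) (a', b') = (T.submatrix (·, b) (·, b') * X) a a' := by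
    simp [onA, Matrix.mul_apply, Fintype.sum_prod_type, Matrix.one_apply]
  simp only [Commute, SemiconjBy, ← Matrix.ext_iff, Prod.forall, hleft, hright]
  exact ⟨fun h b b' a a' => h a b a' b', fun h a b a' b' => h b b' a a'⟩

variable [DecidableEq A]

namespace IsProjFamily

variable {P : ι → Matrix A A ℂ} (hP : IsProjFamily P)
include hP

lemma map_onA : IsProjFamily fun i => onA B (P i) where
  isHermitian i := isHermitian_onA (hP.isHermitian i)
  mul_self i := by rw [← onA_mul, hP.mul_self]
  orthogonal i j hij := by rw [← onA_mul, hP.orthogonal i j hij, onA, Matrix.zero_kronecker]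
  complete := by rw [← onA_sum, hP.complete, onA_one]

lemma mul_eq_ite [DecidableEq ι] (i j : ι) : P i * P j = if i = j then P i else 0 := by
  split_ifs with h
  · rw [← h, hP.mul_self]
  · exact hP.orthogonal i j h

lemma sum_mul_mul (X : Matrix A A ℂ) : ∑ i, ∑ j, P i * X * P j = X := by
  simp only [← Finset.mul_sum, hP.complete, mul_one, ← Finset.sum_mul, one_mul]

lemma eq_iff {X Y : Matrix A A ℂ} : X = Y ↔ ∀ i j, P i * X * P j = P i * Y * P j := by
  refine ⟨fun h _ _ => by rw [h], fun h => ?_⟩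
  rw [← hP.sum_mul_mul X, ← hP.sum_mul_mul Y]
  exact Finset.sum_congr rfl fun i _ => Finset.sum_congr rfl fun j _ => h i j

lemma sum_mul_mul_self_of_commute {X : Matrix A A ℂ} (h : ∀ i, Commute (P i) X) :
    ∑ i, P i * X * P i = X := by
  have hPXP (i : ι) : P i * X * P i = P i * X := by
    rw [mul_assoc, ← (h i).eq, ← mul_assoc, hP.mul_self]
  simp only [hPXP, ← Finset.sum_mul, hP.complete, one_mul]

lemma mul_sum_smul (c : ι → ℂ) (i : ι) : P i * ∑ j, c j • P j = c i • P i := by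
  classical
  simp [Finset.mul_sum, hP.mul_eq_ite]

lemma sum_smul_mul (c : ι → ℂ) (i : ι) : (∑ j, c j • P j) * P i = c i • P i := by
  classical
  simp [Finset.sum_mul, hP.mul_eq_ite]

lemma commute_sum_smul_iff {X : Matrix A A ℂ} {c : ι → ℂ} :
    Commute X (∑ i, c i • P i) ↔ ∀ i j, c i ≠ c j → P i * X * P j = 0 := by
  have hleft (i j : ι) : P i * (X * ∑ k, c k • P k) * P j = c j • (P i * X * P j) := by
    rw [mul_assoc, mul_assoc, hP.sum_smul_mul, mul_smul_comm, mul_smul_comm, ← mul_assoc]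
  have hright (i j : ι) : P i * ((∑ k, c k • P k) * X) * P j = c i • (P i * X * P j) := by
    rw [← mul_assoc, hP.mul_sum_smul, smul_mul_assoc, smul_mul_assoc]
  rw [Commute, SemiconjBy, hP.eq_iff]
  refine forall₂_congr fun i j => ?_
  rw [hleft, hright, ← sub_eq_zero, ← sub_smul, smul_eq_zero, sub_eq_zero, or_iff_not_imp_left,
    ne_comm, ne_eq]

end IsProjFamily

lemma IsProjFamily.commute_onA_sum_kronecker_iff {P : ι → Matrix A A ℂ} (hP : IsProjFamily P)
    {X : Matrix A A ℂ} {τ : ι → Matrix B B ℂ} :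
    Commute (onA B X) (∑ i, P i ⊗ₖ τ i) ↔ ∀ i j, τ i ≠ τ j → P i * X * P j = 0 := by
  have hblock (b b' : B) :
      (∑ i, P i ⊗ₖ τ i).submatrix (·, b) (·, b') = ∑ i, τ i b b' • P i := by
    ext a a'
    simp [Matrix.sum_apply, mul_comm]
  simp only [commute_onA_iff, hblock, hP.commute_sum_smul_iff]
  constructor
  · intro h i j hij
    obtain ⟨b, b', hb⟩ : ∃ b b', τ i b b' ≠ τ j b b' := by
      simpa only [ne_eq, ← Matrix.ext_iff, not_forall] using hij
    exact h b b' i j hb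
  · exact fun h b b' i j hb => h i j fun hτ => hb (by rw [hτ])

end ProjFamilies

section Measurements

lemma rank_eq_trace_of_mul_self {K n : Type*} [Field K] [Fintype n] {P : Matrix n n K}
    (hP : P * P = P) : (P.rank : K) = P.trace := by
  classical
  have hproj : LinearMap.IsProj (LinearMap.range P.toLin') P.toLin' :=
    LinearMap.IsIdempotentElem.isProj_range _ <| by
      rw [IsIdempotentElem, Module.End.mul_eq_comp, ← Matrix.toLin'_mul, hP]
  rw [← Matrix.trace_toLin'_eq, hproj.trace]
  rfl

lemma exists_eq_vecMulVec_of_rank_eq_one {K n : Type*} [Field K] [Fintype n] {M : Matrix n n K}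
    (hM : M.rank = 1) : ∃ v w, M = Matrix.vecMulVec v w := by
  classical
  obtain ⟨v, -, hv⟩ := finrank_eq_one_iff'.1 hM
  choose w hw using fun j => hv ⟨M *ᵥ Pi.single j 1, LinearMap.mem_range_self M.mulVecLin _⟩
  refine ⟨v.1, w, ?_⟩
  ext i j
  simpa [Matrix.vecMulVec_apply, mul_comm] using (congrFun (congrArg Subtype.val (hw j)) i).symm

lemma exists_eq_vecMulVec_star_of_rank_eq_one {𝕜 n : Type*} [RCLike 𝕜] [Fintype n]
    {P : Matrix n n 𝕜} (hP : P.IsHermitian) (hmul : P * P = P) (hrank : P.rank = 1) :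
    ∃ u : n → 𝕜, P = Matrix.vecMulVec u (star u) := by
  obtain ⟨v, w, hvw⟩ := exists_eq_vecMulVec_of_rank_eq_one hrank
  obtain ⟨s, hs⟩ := RCLike.nonneg_iff_exists_ofReal.1 (dotProduct_self_star_nonneg w)
  refine ⟨(√s : 𝕜) • v, ?_⟩
  calc P = P * Pᴴ := by rw [hP.eq, hmul]
    _ = (s : 𝕜) • Matrix.vecMulVec v (star v) := by
      rw [hvw, Matrix.conjTranspose_vecMulVec, Matrix.vecMulVec_mul_vecMulVec, ← hs.2,
        Matrix.vecMulVec_smul]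
    _ = Matrix.vecMulVec ((√s : 𝕜) • v) (star ((√s : 𝕜) • v)) := by
      rw [star_smul, Matrix.smul_vecMulVec, Matrix.vecMulVec_smul, smul_smul, RCLike.star_def,
        RCLike.conj_ofReal, ← RCLike.ofReal_mul, Real.mul_self_sqrt hs.1]

variable {A : Type*} [Fintype A]

/-- The measurement in the orthonormal basis formed by the columns of a unitary matrix `V`: its
`i`-th projector is `|v⟩⟨v|`, with `v` the `i`-th column. -/
noncomputable def basisMeasurement (V : Matrix A A ℂ) (i : A) : Matrix A A ℂ :=
  Matrix.vecMulVec (V.col i) (star (V.col i))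

omit [Fintype A] in
lemma continuous_basisMeasurement (i : A) :
    Continuous fun V : Matrix A A ℂ => basisMeasurement V i := by
  unfold basisMeasurement Matrix.col
  fun_prop

variable [DecidableEq A]

lemma star_col_dotProduct_col {V : Matrix A A ℂ} (hV : V ∈ Matrix.unitaryGroup A ℂ) (i j : A) :
    star (V.col i) ⬝ᵥ V.col j = (1 : Matrix A A ℂ) i j := by
  rw [← Matrix.mem_unitaryGroup_iff'.1 hV]
  rfl

lemma trace_basisMeasurement {V : Matrix A A ℂ} (hV : V ∈ Matrix.unitaryGroup A ℂ) (i : A) :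
    (basisMeasurement V i).trace = 1 := by
  rw [basisMeasurement, Matrix.trace_vecMulVec, dotProduct_comm, star_col_dotProduct_col hV,
    Matrix.one_apply_eq]

lemma basisMeasurement_mul_self {V : Matrix A A ℂ} (hV : V ∈ Matrix.unitaryGroup A ℂ) (i : A) :
    basisMeasurement V i * basisMeasurement V i = basisMeasurement V i := by
  rw [basisMeasurement, Matrix.vecMulVec_mul_vecMulVec, star_col_dotProduct_col hV,
    Matrix.one_apply_eq, one_smul]

omit [DecidableEq A] in
lemma sum_basisMeasurement (V : Matrix A A ℂ) : ∑ i, basisMeasurement V i = V * Vᴴ := by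
  ext a b
  simp [basisMeasurement, Matrix.sum_apply, Matrix.mul_apply, Matrix.vecMulVec_apply]

lemma isMeasurement_basisMeasurement {V : Matrix A A ℂ} (hV : V ∈ Matrix.unitaryGroup A ℂ) :
    IsMeasurement (basisMeasurement V) where
  isHermitian i := by
    rw [Matrix.IsHermitian, basisMeasurement, Matrix.conjTranspose_vecMulVec, star_star]
  mul_self := basisMeasurement_mul_self hV
  orthogonal i j hij := by
    rw [basisMeasurement, basisMeasurement, Matrix.vecMulVec_mul_vecMulVec,
      star_col_dotProduct_col hV, Matrix.one_apply_ne hij, zero_smul, Matrix.vecMulVec_zero]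
  complete := by rw [sum_basisMeasurement]; exact Matrix.mem_unitaryGroup_iff.1 hV
  rank_eq_one i := by
    have h := rank_eq_trace_of_mul_self (basisMeasurement_mul_self hV i)
    rw [trace_basisMeasurement hV] at h
    exact_mod_cast h

namespace IsMeasurement

variable {P : A → Matrix A A ℂ} (hP : IsMeasurement P)
include hP

lemma exists_eq_vecMulVec_star (i : A) : ∃ u : A → ℂ, P i = Matrix.vecMulVec u (star u) :=
  exists_eq_vecMulVec_star_of_rank_eq_one (hP.isHermitian i) (hP.mul_self i) (hP.rank_eq_one i)

lemma exists_unitary : ∃ V ∈ Matrix.unitaryGroup A ℂ, P = basisMeasurement V := by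
  choose u hu using hP.exists_eq_vecMulVec_star
  have hPV : P = basisMeasurement (Matrix.of fun a i => u i a) := funext hu
  refine ⟨Matrix.of fun a i => u i a, Matrix.mem_unitaryGroup_iff.2 ?_, hPV⟩
  rw [Matrix.star_eq_conjTranspose, ← sum_basisMeasurement, ← hPV, hP.complete]

lemma trace_eq_one (i : A) : (P i).trace = 1 := by
  rw [← rank_eq_trace_of_mul_self (hP.mul_self i), hP.rank_eq_one, Nat.cast_one]

end IsMeasurement

lemma isCompact_unitaryGroup {𝕜 : Type*} [RCLike 𝕜] :
    IsCompact (Matrix.unitaryGroup A 𝕜 : Set (Matrix A A 𝕜)) := by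
  have hbox : IsCompact
      (Set.univ.pi fun _ : A => Set.univ.pi fun _ : A => Metric.closedBall (0 : 𝕜) 1) :=
    isCompact_univ_pi fun _ => isCompact_univ_pi fun _ => isCompact_closedBall _ _
  refine hbox.of_isClosed_subset ?_ fun V hV a _ b _ =>
    mem_closedBall_zero_iff.2 (entry_norm_bound_of_unitary hV a b)
  have hunitary : (Matrix.unitaryGroup A 𝕜 : Set (Matrix A A 𝕜)) = {V | V * Vᴴ = 1} :=
    Set.ext fun V => Matrix.mem_unitaryGroup_iff
  rw [hunitary]
  exact isClosed_eq (by fun_prop) continuous_const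

end Measurements

section JointDiagonalization

lemma exists_orthonormalBasis_eigenvectors {𝕜 E ι : Type*} [RCLike 𝕜] [NormedAddCommGroup E]
    [InnerProductSpace 𝕜 E] [FiniteDimensional 𝕜 E] [Fintype ι]
    (hι : Module.finrank 𝕜 E = Fintype.card ι) {S T : E →ₗ[𝕜] E} (hS : S.IsSymmetric)
    (hT : T.IsSymmetric) (hST : Commute S T) :
    ∃ (b : OrthonormalBasis ι 𝕜 E) (c d : ι → 𝕜),
      (∀ i, S (b i) = c i • b i) ∧ ∀ i, T (b i) = d i • b i := by
  classical
  let W : 𝕜 × 𝕜 → Submodule 𝕜 E := fun μ =>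
    Module.End.eigenspace S μ.2 ⊓ Module.End.eigenspace T μ.1
  have hW : DirectSum.IsInternal W :=
    LinearMap.IsSymmetric.directSum_isInternal_of_commute hS hT hST
  have : Finite {μ // W μ ≠ ⊥} := WellFoundedGT.finite_ne_bot_of_iSupIndep hW.submodule_iSupIndep
  have := Fintype.ofFinite {μ // W μ ≠ ⊥}
  have hW' := DirectSum.isInternal_ne_bot_iff.2 hW
  have horth := (LinearMap.IsSymmetric.orthogonalFamily_eigenspace_inf_eigenspace hS hT).comp
    (γ := {μ // W μ ≠ ⊥}) Subtype.val_injective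
  let b := (hW'.subordinateOrthonormalBasis hι horth).reindex (Fintype.equivFin ι).symm
  have hb (i : ι) : ∃ μ : 𝕜 × 𝕜, b i ∈ W μ := by
    have h := hW'.subordinateOrthonormalBasis_subordinate hι (Fintype.equivFin ι i) horth
    exact ⟨_, by simpa only [b, OrthonormalBasis.reindex_apply, Equiv.symm_symm] using h⟩
  choose μ hμ using hb
  exact ⟨b, fun i => (μ i).2, fun i => (μ i).1, fun i => Module.End.mem_eigenspace_iff.1 (hμ i).1,
    fun i => Module.End.mem_eigenspace_iff.1 (hμ i).2⟩

variable {A : Type*} [Fintype A] [DecidableEq A]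

lemma eq_sum_smul_basisMeasurement {M V : Matrix A A ℂ} (hV : V ∈ Matrix.unitaryGroup A ℂ)
    {c : A → ℂ} (hc : ∀ i, M *ᵥ V.col i = c i • V.col i) :
    M = ∑ i, c i • basisMeasurement V i :=
  calc M = ∑ i, M * basisMeasurement V i := by
        rw [← Finset.mul_sum, (isMeasurement_basisMeasurement hV).complete, mul_one]
    _ = ∑ i, c i • basisMeasurement V i := Finset.sum_congr rfl fun i _ => by
        rw [basisMeasurement, Matrix.mul_vecMulVec, hc, Matrix.smul_vecMulVec]

lemma exists_measurement_commute {M N : Matrix A A ℂ} (hM : M.IsHermitian) (hN : N.IsHermitian)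
    (hMN : Commute M N) :
    ∃ P : A → Matrix A A ℂ, IsMeasurement P ∧ ∀ i, Commute (P i) M ∧ Commute (P i) N := by
  have hcomm : Commute (Matrix.toEuclideanLin M) (Matrix.toEuclideanLin N) :=
    LinearMap.ext fun x => by
      have h : M *ᵥ (N *ᵥ x.ofLp) = N *ᵥ (M *ᵥ x.ofLp) := by
        rw [Matrix.mulVec_mulVec, Matrix.mulVec_mulVec, hMN.eq]
      simpa [Matrix.toEuclideanLin, Matrix.toLpLin_apply] using h
  obtain ⟨b, c, d, hc, hd⟩ := exists_orthonormalBasis_eigenvectors finrank_euclideanSpace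
    (Matrix.isSymmetric_toEuclideanLin_iff.2 hM) (Matrix.isSymmetric_toEuclideanLin_iff.2 hN) hcomm
  let V := (EuclideanSpace.basisFun A ℂ).toBasis.toMatrix b
  have hV : V ∈ Matrix.unitaryGroup A ℂ :=
    OrthonormalBasis.toMatrix_orthonormalBasis_mem_unitary _ _
  have hP := isMeasurement_basisMeasurement hV
  have hdiag {L : Matrix A A ℂ} {l : A → ℂ} (hl : ∀ i, Matrix.toEuclideanLin L (b i) = l i • b i)
      (i : A) : Commute (basisMeasurement V i) L := by
    rw [eq_sum_smul_basisMeasurement hV fun i => congrArg WithLp.ofLp (hl i)]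
    exact (hP.mul_sum_smul l i).trans (hP.sum_smul_mul l i).symm
  exact ⟨basisMeasurement V, hP, fun i => ⟨hdiag hc i, hdiag hd i⟩⟩

variable {B ι : Type*} [Fintype B] [DecidableEq B] [Fintype ι]

lemma IsProjFamily.exists_measurement_commute {P : ι → Matrix A A ℂ} (hP : IsProjFamily P)
    {H : Matrix A A ℂ} (hH : H.IsHermitian) {τ : ι → Matrix B B ℂ}
    (hcomm : Commute (onA B H) (∑ i, P i ⊗ₖ τ i)) :
    ∃ P' : A → Matrix A A ℂ, IsMeasurement P' ∧
      ∀ k, Commute (onA B (P' k)) (onA B H * ∑ i, P i ⊗ₖ τ i) := by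
  -- `f` separates the values of `τ`, so `∑ f i • P i` and `∑ P i ⊗ τ i` commute with the same `X`.
  obtain ⟨f, hf⟩ : ∃ f : ι → ℝ, ∀ i j, f i = f j ↔ τ i = τ j :=
    ⟨fun i => ((Finite.equivFin (Set.range τ) ⟨τ i, Set.mem_range_self i⟩ : ℕ) : ℝ),
      fun i j => by rw [Nat.cast_inj, Fin.val_inj, EmbeddingLike.apply_eq_iff_eq, Subtype.mk.injEq]⟩
  have hiff (X : Matrix A A ℂ) :
      Commute X (∑ i, (f i : ℂ) • P i) ↔ Commute (onA B X) (∑ i, P i ⊗ₖ τ i) := by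
    rw [hP.commute_sum_smul_iff, hP.commute_onA_sum_kronecker_iff]
    simp only [ne_eq, Complex.ofReal_inj, hf]
  have hherm : (∑ i, (f i : ℂ) • P i).IsHermitian :=
    isHermitian_sum fun i => (hP.isHermitian i).smul (Complex.conj_ofReal _)
  obtain ⟨P', hP', hc⟩ := QDiscord.exists_measurement_commute hH hherm ((hiff H).2 hcomm)
  refine ⟨P', hP', fun k => Commute.mul_right ?_ ((hiff (P' k)).1 (hc k).2)⟩
  rw [Commute, SemiconjBy, ← onA_mul, ← onA_mul, (hc k).1.eq]

end JointDiagonalization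

section OrthogonalSums

lemma sum_pow_succ_of_orthogonal {R ι : Type*} [Semiring R] [Fintype ι] {a : ι → R}
    (ha : Pairwise fun i j => a i * a j = 0) (k : ℕ) :
    (∑ i, a i) ^ (k + 1) = ∑ i, a i ^ (k + 1) := by
  classical
  induction k with
  | zero => simp
  | succ k ih =>
    have mul_pow_succ (i j : ι) : a j * a i ^ (k + 1) = if j = i then a i ^ (k + 2) else 0 := by
      split_ifs with h
      · rw [h, ← pow_succ']
      · rw [pow_succ', ← mul_assoc, ha h, zero_mul]
    simp only [pow_succ' (∑ i, a i) (k + 1), ih, Finset.sum_mul_sum, mul_pow_succ,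
      Finset.sum_ite_eq, Finset.mem_univ, if_true]

lemma aeval_sum_of_orthogonal {R S ι : Type*} [CommSemiring R] [Semiring S] [Algebra R S]
    [Fintype ι] {a : ι → S} (ha : Pairwise fun i j => a i * a j = 0) {q : Polynomial R}
    (hq : q.coeff 0 = 0) : Polynomial.aeval (∑ i, a i) q = ∑ i, Polynomial.aeval (a i) q := by
  simp only [Polynomial.aeval_eq_sum_range]
  rw [Finset.sum_comm]
  refine Finset.sum_congr rfl fun k _ => ?_
  rw [← Finset.smul_sum]
  cases k with
  | zero => simp [hq]
  | succ k => rw [sum_pow_succ_of_orthogonal ha]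

variable {𝕜 n ι : Type*} [RCLike 𝕜] [Fintype n] [DecidableEq n] [Fintype ι]

lemma cfc_sum_of_orthogonal {M : ι → Matrix n n 𝕜} (hM : ∀ i, (M i).IsHermitian)
    (orthogonal : Pairwise fun i j => M i * M j = 0) {f : ℝ → ℝ} (hf : f 0 = 0) :
    cfc f (∑ i, M i) = ∑ i, cfc f (M i) := by
  obtain ⟨q, hq⟩ := exists_polynomial_eval_eq (f := f)
    (s := insert 0 (spectrum ℝ (∑ i, M i) ∪ ⋃ i, spectrum ℝ (M i)))
    ((Matrix.finite_real_spectrum.union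
      (Set.finite_iUnion fun _ => Matrix.finite_real_spectrum)).insert 0)
  have coeff_zero : q.coeff 0 = 0 := by
    rw [Polynomial.coeff_zero_eq_eval_zero, hq 0 (Set.mem_insert _ _), hf]
  rw [← aeval_eq_cfc (isHermitian_sum hM) fun x hx => hq x (.inr (.inl hx)),
    aeval_sum_of_orthogonal orthogonal coeff_zero]
  exact Finset.sum_congr rfl fun i _ =>
    aeval_eq_cfc (hM i) fun x hx => hq x (.inr (.inr (Set.mem_iUnion_of_mem i hx)))

end OrthogonalSums

section Entropy

variable {n : Type*} [Fintype n] [DecidableEq n]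

lemma log_two_mul_entropy {M : Matrix n n ℂ} (hM : M.IsHermitian) :
    Real.log 2 * entropy M = (cfc Real.negMulLog M).trace.re := by
  have log_two_ne_zero : Real.log 2 ≠ 0 := (Real.log_pos one_lt_two).ne'
  rw [entropy, dif_pos hM, trace_cfc hM, Complex.re_sum, Finset.mul_sum]
  refine Finset.sum_congr rfl fun i _ => ?_
  rw [RCLike.ofReal_eq_complex_ofReal, Complex.ofReal_re, Real.negMulLog, Real.logb]
  field_simp

lemma entropy_eq {M : Matrix n n ℂ} (hM : M.IsHermitian) :
    entropy M = (cfc Real.negMulLog M).trace.re / Real.log 2 :=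
  eq_div_of_mul_eq (Real.log_pos one_lt_two).ne' (by rw [mul_comm, log_two_mul_entropy hM])

lemma re_trace_mul_cfc_log {M : Matrix n n ℂ} (hM : M.IsHermitian) :
    (M * cfc Real.log M).trace.re = -(Real.log 2 * entropy M) := by
  rw [log_two_mul_entropy hM, mul_cfc hM, Real.negMulLog_eq_neg, cfc_neg, Matrix.trace_neg,
    Complex.neg_re, neg_neg]

open scoped Matrix.Norms.L2Operator in
lemma continuous_entropy_comp {X : Type*} [TopologicalSpace X] {M : X → Matrix n n ℂ}
    (hM : Continuous M) (isHermitian : ∀ x, (M x).IsHermitian) :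
    Continuous fun x => entropy (M x) := by
  have continuous_cfc : Continuous fun x => cfc Real.negMulLog (M x) :=
    Continuous.cfc_of_mem_nhdsSet (p := IsSelfAdjoint) (s := Set.univ) _ univ_mem hM
      (fun x => (isHermitian x).isSelfAdjoint) Real.continuous_negMulLog.continuousOn
  simp only [entropy_eq (isHermitian _)]
  fun_prop

lemma entropy_sum_of_orthogonal {ι : Type*} [Fintype ι] {M : ι → Matrix n n ℂ}
    (hM : ∀ i, (M i).IsHermitian) (orthogonal : Pairwise fun i j => M i * M j = 0) :
    entropy (∑ i, M i) = ∑ i, entropy (M i) := by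
  simp only [entropy_eq (isHermitian_sum hM), entropy_eq (hM _), ← Finset.sum_div,
    cfc_sum_of_orthogonal hM orthogonal Real.negMulLog_zero, Matrix.trace_sum, Complex.re_sum]

lemma entropy_smul {M : Matrix n n ℂ} (hM : M.IsHermitian) (c : ℝ) :
    entropy (c • M) = c * entropy M - c * Real.logb 2 c * M.trace.re := by
  have cfc_smul : cfc Real.negMulLog (c • M) =
      c.negMulLog • M + c • cfc Real.negMulLog M := by
    rw [← cfc_comp_const_mul c _ M ((Matrix.finite_real_spectrum.image _).continuousOn _)
      hM.isSelfAdjoint, ← cfc_const_mul_id c.negMulLog M hM.isSelfAdjoint,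
      ← cfc_const_mul _ _ M (continuousOn_spectrum _ M),
      ← cfc_add M _ _ (continuousOn_spectrum _ M) (continuousOn_spectrum _ M)]
    exact cfc_congr fun x _ => by rw [Real.negMulLog_mul]; ring
  rw [entropy_eq (hM.smul (IsSelfAdjoint.all c)), entropy_eq hM, cfc_smul, Real.negMulLog,
    Real.logb]
  simp only [Matrix.trace_add, Matrix.trace_smul, Complex.add_re, Complex.smul_re, smul_eq_mul]
  ring

lemma entropy_eq_zero_of_mul_self {P : Matrix n n ℂ} (hP : P.IsHermitian) (hPP : P * P = P) :
    entropy P = 0 := by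
  have cfc_eq_zero : cfc Real.negMulLog P = 0 := by
    rw [← cfc_const_zero ℝ P]
    refine cfc_congr fun x hx => ?_
    rcases IsIdempotentElem.spectrum_subset ℝ hPP hx with rfl | rfl <;> simp
  simp [entropy_eq hP, cfc_eq_zero]

lemma trace_mul_entropy_inv_trace_smul {M : Matrix n n ℂ} (hM : M.PosSemidef) :
    M.trace.re * entropy (M.trace.re⁻¹ • M) =
      entropy M + M.trace.re * Real.logb 2 M.trace.re := by
  rw [entropy_smul hM.isHermitian, Real.logb_inv]
  rcases eq_or_ne M.trace.re 0 with h | h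
  · have hM₀ : M = 0 := hM.trace_eq_zero_iff.1
      (Complex.ext h (Complex.nonneg_iff.1 hM.trace_nonneg).2.symm)
    simp [hM₀, entropy_eq_zero_of_mul_self]
  · field_simp
    ring

end Entropy

section Pinching

variable {n ι : Type*} [Fintype n] [DecidableEq n] [Fintype ι]

namespace IsProjFamily

variable {Q : ι → Matrix n n ℂ} (hQ : IsProjFamily Q)
include hQ

lemma trace_mul_eq_sum_of_commute {X : Matrix n n ℂ} (hX : ∀ i, Commute (Q i) X)
    (Y : Matrix n n ℂ) : (Y * X).trace = ∑ i, (Q i * Y * Q i * X).trace := by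
  rw [← hQ.sum_mul_mul_self_of_commute hX, Finset.mul_sum, Matrix.trace_sum]
  refine Finset.sum_congr rfl fun i _ => ?_
  rw [hQ.sum_mul_mul_self_of_commute hX, ← mul_assoc, ← mul_assoc, Matrix.trace_mul_comm,
    ← mul_assoc, ← mul_assoc]

variable {R : ι → Matrix n n ℂ}

lemma mul_eq_ite_of_mul_eq_self [DecidableEq ι] (hQR : ∀ i, Q i * R i = R i) (i j : ι) :
    Q i * R j = if i = j then R j else 0 := by
  rw [← hQR j, ← mul_assoc, hQ.mul_eq_ite, hQR]
  split_ifs with h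
  · rw [h, hQR]
  · rw [zero_mul]

lemma mul_sum_of_mul_eq_self (hQR : ∀ i, Q i * R i = R i) (i : ι) : Q i * ∑ j, R j = R i := by
  classical
  simp [Finset.mul_sum, hQ.mul_eq_ite_of_mul_eq_self hQR]

variable (hR : ∀ i, (R i).IsHermitian) (hQR : ∀ i, Q i * R i = R i)
include hR hQR

lemma self_mul_of_mul_eq_self (i : ι) : R i * Q i = R i := by
  rw [← (hR i).eq, ← (hQ.isHermitian i).eq, ← Matrix.conjTranspose_mul, hQR]

lemma commute_sum_of_mul_eq_self (i : ι) : Commute (Q i) (∑ j, R j) := by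
  have h := congrArg Matrix.conjTranspose (hQ.mul_sum_of_mul_eq_self hQR i)
  rw [Matrix.conjTranspose_mul, (isHermitian_sum hR).eq, (hQ.isHermitian i).eq, (hR i).eq] at h
  rw [Commute, SemiconjBy, h, hQ.mul_sum_of_mul_eq_self hQR]

lemma orthogonal_of_mul_eq_self : Pairwise fun i j => R i * R j = 0 := by
  intro i j hij
  rw [← hQ.self_mul_of_mul_eq_self hR hQR, mul_assoc, ← hQR j, ← mul_assoc (Q i),
    hQ.orthogonal i j hij, zero_mul, mul_zero]

lemma mul_cfc_sum (f : ℝ → ℝ) (i : ι) : R i * cfc f (∑ j, R j) = R i * cfc f (R i) := by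
  classical
  calc R i * cfc f (∑ j, R j)
    _ = Q i * cfc (fun x => x * f x) (∑ j, R j) := by
      rw [← mul_cfc (isHermitian_sum hR), ← mul_assoc, hQ.mul_sum_of_mul_eq_self hQR]
    _ = ∑ j, Q i * R j * cfc f (R j) := by
      simp only [cfc_sum_of_orthogonal hR (hQ.orthogonal_of_mul_eq_self hR hQR)
        (f := fun x => x * f x) (zero_mul _), Finset.mul_sum, ← mul_cfc (hR _), mul_assoc]
    _ = R i * cfc f (R i) := by simp [hQ.mul_eq_ite_of_mul_eq_self hQR]

lemma trace_mul_cfc_sum {Y : Matrix n n ℂ} {p : ι → ℝ} (hY : ∀ i, Q i * Y * Q i = p i • R i)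
    (f : ℝ → ℝ) :
    (Y * cfc f (∑ i, R i)).trace = ∑ i, p i • (R i * cfc f (R i)).trace := by
  rw [hQ.trace_mul_eq_sum_of_commute fun i =>
    ((hQ.commute_sum_of_mul_eq_self hR hQR i).symm.cfc_real f).symm]
  simp only [hY, smul_mul_assoc, Matrix.trace_smul, hQ.mul_cfc_sum hR hQR]

end IsProjFamily

end Pinching

section PartialTraces

variable {A B : Type*}

lemma posSemidef_onA [Finite A] [Finite B] [DecidableEq B] {M : Matrix A A ℂ}
    (hM : M.PosSemidef) : (onA B M).PosSemidef :=
  hM.kronecker .one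

lemma trB_kronecker [Fintype B] (M : Matrix A A ℂ) (N : Matrix B B ℂ) :
    trB (M ⊗ₖ N) = N.trace • M := by
  ext a a'
  simp [trB, ← Finset.mul_sum, Matrix.trace, mul_comm]

lemma trB_sum [Fintype B] {ι : Type*} [Fintype ι] (X : ι → Matrix (A × B) (A × B) ℂ) :
    trB (∑ i, X i) = ∑ i, trB (X i) := by
  ext a a'
  simp only [trB, Matrix.of_apply, Matrix.sum_apply]
  exact Finset.sum_comm

lemma posSemidef_trB [Fintype B] {ρ : Matrix (A × B) (A × B) ℂ} (hρ : ρ.PosSemidef) :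
    (trB ρ).PosSemidef := by
  have trB_eq : trB ρ = ∑ b : B, ρ.submatrix (·, b) (·, b) := by
    ext a a'
    simp [trB, Matrix.sum_apply]
  rw [trB_eq]
  exact Matrix.posSemidef_sum _ fun b _ => hρ.submatrix _

variable [Fintype A]

lemma trA_kronecker (M : Matrix A A ℂ) (N : Matrix B B ℂ) : trA (M ⊗ₖ N) = M.trace • N := by
  ext b b'
  simp [trA, ← Finset.sum_mul, Matrix.trace]

lemma posSemidef_trA {ρ : Matrix (A × B) (A × B) ℂ} (hρ : ρ.PosSemidef) :
    (trA ρ).PosSemidef := by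
  have trA_eq : trA ρ = ∑ a : A, ρ.submatrix (a, ·) (a, ·) := by
    ext b b'
    simp [trA, Matrix.sum_apply]
  rw [trA_eq]
  exact Matrix.posSemidef_sum _ fun a _ => hρ.submatrix _

variable [Fintype B]

lemma trace_trA (X : Matrix (A × B) (A × B) ℂ) : (trA X).trace = X.trace := by
  simp only [Matrix.trace, Matrix.diag_apply, trA, Matrix.of_apply, Fintype.sum_prod_type]
  exact Finset.sum_comm

variable [DecidableEq B]

lemma trace_mul_onA (ρ : Matrix (A × B) (A × B) ℂ) (X : Matrix A A ℂ) :
    (ρ * onA B X).trace = (trB ρ * X).trace := by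
  simp only [Matrix.trace, Matrix.diag_apply, Matrix.mul_apply, onA, trB, Matrix.of_apply,
    Fintype.sum_prod_type, Matrix.kroneckerMap_apply, Matrix.one_apply, mul_ite, mul_one, mul_zero,
    Finset.sum_ite_eq', Finset.mem_univ, if_true, Finset.sum_mul]
  exact Finset.sum_congr rfl fun a _ => Finset.sum_comm

lemma cfc_onA [DecidableEq A] {M : Matrix A A ℂ} (hM : M.IsHermitian) (f : ℝ → ℝ) :
    cfc f (onA B M) = onA B (cfc f M) := by
  let onAHom : Matrix A A ℂ →⋆ₐ[ℝ] Matrix (A × B) (A × B) ℂ :=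
    { toFun := onA B
      map_one' := onA_one
      map_mul' := onA_mul
      map_zero' := Matrix.zero_kronecker _
      map_add' := fun M N => Matrix.add_kronecker M N _
      commutes' := fun r => by
        rw [Algebra.algebraMap_eq_smul_one, Algebra.algebraMap_eq_smul_one, onA,
          Matrix.smul_kronecker, ← onA, onA_one]
      map_star' := fun M => by
        simp only [Matrix.star_eq_conjTranspose, onA, Matrix.conjTranspose_kronecker,
          Matrix.conjTranspose_one] }
  exact (StarAlgHomClass.map_cfc (S := ℝ) onAHom f M (continuousOn_spectrum f M) continuous_onA
    hM.isSelfAdjoint (isHermitian_onA hM).isSelfAdjoint).symm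

end PartialTraces

section Outcomes

variable {A B : Type*} [Fintype A] [Fintype B] [DecidableEq B]

/-- The unnormalized state of `B` after the outcome `M` of a measurement on `A`: for a rank-one
projector `M` it is the operator `σ` with `(M ⊗ 1) ρ (M ⊗ 1) = M ⊗ σ`. -/
def outcomeBlock (ρ : Matrix (A × B) (A × B) ℂ) (M : Matrix A A ℂ) : Matrix B B ℂ :=
  trA (onA B M * ρ * onA B M)

lemma exists_onA_mul_mul_onA_eq_kronecker {M : Matrix A A ℂ} (hM : M.rank = 1)
    (X : Matrix (A × B) (A × B) ℂ) : ∃ S : Matrix B B ℂ, onA B M * X * onA B M = M ⊗ₖ S := by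
  obtain ⟨v, w, rfl⟩ := exists_eq_vecMulVec_of_rank_eq_one hM
  refine ⟨Matrix.of fun b b' => ∑ a', ∑ a, w a * X (a, b) (a', b') * v a', ?_⟩
  ext x y
  simp only [Matrix.mul_apply, onA, Matrix.kroneckerMap_apply, Matrix.vecMulVec_apply,
    Matrix.one_apply, Fintype.sum_prod_type, Matrix.of_apply, mul_ite, ite_mul, mul_one, mul_zero,
    zero_mul, Finset.sum_ite_eq, Finset.sum_ite_eq', Finset.mem_univ, if_true, Finset.sum_mul,
    Finset.mul_sum]
  exact Finset.sum_congr rfl fun a' _ => Finset.sum_congr rfl fun a _ => by ring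

lemma onA_mul_mul_onA_eq_kronecker {M : Matrix A A ℂ} (hrank : M.rank = 1) (htrace : M.trace = 1)
    (ρ : Matrix (A × B) (A × B) ℂ) : onA B M * ρ * onA B M = M ⊗ₖ outcomeBlock ρ M := by
  obtain ⟨S, hS⟩ := exists_onA_mul_mul_onA_eq_kronecker hrank ρ
  rw [outcomeBlock, hS, trA_kronecker, htrace, one_smul]

variable {ρ : Matrix (A × B) (A × B) ℂ} (hρ : ρ.PosSemidef) {M : Matrix A A ℂ}
  (hM : M.IsHermitian)
include hρ hM

lemma posSemidef_onA_mul_mul_onA : (onA B M * ρ * onA B M).PosSemidef := by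
  nth_rewrite 2 [← (isHermitian_onA hM).eq]
  exact hρ.mul_mul_conjTranspose_same _

lemma posSemidef_outcomeBlock : (outcomeBlock ρ M).PosSemidef :=
  posSemidef_trA (posSemidef_onA_mul_mul_onA hρ hM)

variable (hMM : M * M = M)
include hMM

lemma trace_onA_mul_mul_onA : (onA B M * ρ * onA B M).trace = outcomeProb ρ M := by
  have trace_eq : (onA B M * ρ * onA B M).trace = (onA B M * ρ).trace := by
    rw [Matrix.trace_mul_comm, ← mul_assoc, ← onA_mul, hMM]
  rw [outcomeProb, ← trace_eq]
  exact Complex.eq_re_of_ofReal_le (r := 0)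
    (by simpa using (posSemidef_onA_mul_mul_onA hρ hM).trace_nonneg)

lemma trace_onA_mul : (onA B M * ρ).trace = outcomeProb ρ M := by
  rw [← trace_onA_mul_mul_onA hρ hM hMM, Matrix.trace_mul_comm _ (onA B M), ← mul_assoc,
    ← onA_mul, hMM]

lemma trace_outcomeBlock : (outcomeBlock ρ M).trace = outcomeProb ρ M := by
  rw [outcomeBlock, trace_trA, trace_onA_mul_mul_onA hρ hM hMM]

lemma outcomeProb_nonneg : 0 ≤ outcomeProb ρ M := by
  have h := (posSemidef_onA_mul_mul_onA hρ hM).trace_nonneg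
  rw [trace_onA_mul_mul_onA hρ hM hMM] at h
  exact_mod_cast h

lemma outcomeProb_smul_postState :
    outcomeProb ρ M • postState ρ M = onA B M * ρ * onA B M := by
  rcases eq_or_ne (outcomeProb ρ M) 0 with h | h
  · have hzero : onA B M * ρ * onA B M = 0 :=
      (posSemidef_onA_mul_mul_onA hρ hM).trace_eq_zero_iff.1 (by
        rw [trace_onA_mul_mul_onA hρ hM hMM, h, Complex.ofReal_zero])
    rw [h, zero_smul, hzero]
  · rw [postState, ← Complex.ofReal_inv, Complex.coe_smul, smul_smul, mul_inv_cancel₀ h, one_smul]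

lemma posSemidef_postState : (postState ρ M).PosSemidef := by
  rw [postState, ← Complex.ofReal_inv]
  exact (posSemidef_onA_mul_mul_onA hρ hM).smul
    (by exact_mod_cast inv_nonneg.2 (outcomeProb_nonneg hρ hM hMM))

lemma outcomeProb_mul_entropy_postState [DecidableEq A] :
    outcomeProb ρ M * entropy (postState ρ M) = entropy (onA B M * ρ * onA B M) +
      outcomeProb ρ M * Real.logb 2 (outcomeProb ρ M) := by
  have h := trace_mul_entropy_inv_trace_smul (posSemidef_onA_mul_mul_onA hρ hM)
  rwa [trace_onA_mul_mul_onA hρ hM hMM, Complex.ofReal_re, ← Complex.coe_smul,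
    Complex.ofReal_inv, ← postState] at h

end Outcomes

section States

variable {A : Type*} [Fintype A]

lemma nonempty_of_isState {ρ : Matrix A A ℂ} (hρ : IsState ρ) : Nonempty A := by
  by_contra h
  have := not_nonempty_iff.1 h
  simpa [Matrix.trace] using hρ.trace_eq_one

lemma exists_isState [Nonempty A] : ∃ τ : Matrix A A ℂ, IsState τ := by
  classical
  obtain ⟨b⟩ := ‹Nonempty A›
  exact ⟨Matrix.diagonal (Pi.single b 1), .diagonal (Pi.single_nonneg.2 zero_le_one), by simp⟩

lemma exists_isState_eq_trace_smul [Nonempty A] {σ : Matrix A A ℂ} (hσ : σ.PosSemidef) :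
    ∃ τ, IsState τ ∧ σ = σ.trace • τ := by
  rcases eq_or_ne σ.trace 0 with h | h
  · obtain ⟨τ, hτ⟩ := exists_isState (A := A)
    exact ⟨τ, hτ, by rw [h, zero_smul, hσ.trace_eq_zero_iff.1 h]⟩
  · refine ⟨σ.trace⁻¹ • σ, ⟨hσ.smul (inv_nonneg.2 hσ.trace_nonneg), ?_⟩, ?_⟩
    · rw [Matrix.trace_smul, smul_eq_mul, inv_mul_cancel₀ h]
    · rw [smul_smul, mul_inv_cancel₀ h, one_smul]

end States

section Discord

variable {A B ι : Type*} [Fintype A] [DecidableEq A] [Fintype B] [DecidableEq B] [Fintype ι]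

lemma IsProjFamily.sum_outcomeProb {P : ι → Matrix A A ℂ} (hP : IsProjFamily P)
    (ρ : Matrix (A × B) (A × B) ℂ) : ∑ i, outcomeProb ρ (P i) = ρ.trace.re := by
  simp only [outcomeProb]
  rw [← Complex.re_sum, ← Matrix.trace_sum, ← Finset.sum_mul, hP.map_onA.complete, one_mul]

lemma mutualI_sub_mutualJ (ρ : Matrix (A × B) (A × B) ℂ) (P : A → Matrix A A ℂ) :
    mutualI ρ - mutualJ ρ P = entropy (trB ρ) - entropy ρ + condEntropy ρ P := by
  rw [mutualI, mutualJ]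
  ring

section Marginal

variable {ρ : Matrix (A × B) (A × B) ℂ} (hρ : ρ.PosSemidef)
include hρ

lemma trace_mul_kerProj_onA_trB : (ρ * kerProj (onA B (trB ρ))).trace = 0 := by
  have hA := (posSemidef_trB hρ).isHermitian
  rw [kerProj, cfc_onA hA, trace_mul_onA, ← kerProj, mul_kerProj hA, Matrix.trace_zero]

lemma re_trace_mul_cfc_log_onA_trB :
    (ρ * cfc Real.log (onA B (trB ρ))).trace.re = -(Real.log 2 * entropy (trB ρ)) := by
  have hA := (posSemidef_trB hρ).isHermitian
  rw [cfc_onA hA, trace_mul_onA, re_trace_mul_cfc_log hA]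

end Marginal

namespace IsProjFamily

variable {ρ : Matrix (A × B) (A × B) ℂ} {P : ι → Matrix A A ℂ} (hP : IsProjFamily P)
include hP

lemma onA_mul_postState (i : ι) : onA B (P i) * postState ρ (P i) = postState ρ (P i) := by
  rw [postState, mul_smul_comm, ← mul_assoc, ← mul_assoc, ← onA_mul, hP.mul_self]

variable (hρ : ρ.PosSemidef)
include hρ

lemma isHermitian_postState (i : ι) : (postState ρ (P i)).IsHermitian :=
  (posSemidef_postState hρ (hP.isHermitian i) (hP.mul_self i)).isHermitian

lemma trace_mul_cfc_sum_postState (f : ℝ → ℝ) :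
    (ρ * cfc f (∑ i, postState ρ (P i))).trace =
      ∑ i, outcomeProb ρ (P i) • (postState ρ (P i) * cfc f (postState ρ (P i))).trace :=
  hP.map_onA.trace_mul_cfc_sum (hP.isHermitian_postState hρ) hP.onA_mul_postState
    (fun i => (outcomeProb_smul_postState hρ (hP.isHermitian i) (hP.mul_self i)).symm) f

lemma trace_mul_kerProj_sum_postState :
    (ρ * kerProj (∑ i, postState ρ (P i))).trace = 0 := by
  rw [kerProj, hP.trace_mul_cfc_sum_postState hρ]
  refine Finset.sum_eq_zero fun i _ => ?_
  rw [← kerProj, mul_kerProj (hP.isHermitian_postState hρ i), Matrix.trace_zero, smul_zero]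

end IsProjFamily

namespace IsMeasurement

variable {ρ : Matrix (A × B) (A × B) ℂ} {P : A → Matrix A A ℂ} (hP : IsMeasurement P)
include hP

lemma onA_mul_mul_onA (ρ : Matrix (A × B) (A × B) ℂ) (i : A) :
    onA B (P i) * ρ * onA B (P i) = P i ⊗ₖ outcomeBlock ρ (P i) :=
  onA_mul_mul_onA_eq_kronecker (hP.rank_eq_one i) (hP.trace_eq_one i) ρ

lemma postState_eq (ρ : Matrix (A × B) (A × B) ℂ) (i : A) :
    postState ρ (P i) = P i ⊗ₖ ((outcomeProb ρ (P i) : ℂ)⁻¹ • outcomeBlock ρ (P i)) := by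
  rw [postState, hP.onA_mul_mul_onA, Matrix.kronecker_smul]

section Pos

variable (hρ : ρ.PosSemidef)
include hρ

lemma re_trace_mul_cfc_log_sum_postState :
    (ρ * cfc Real.log (∑ i, postState ρ (P i))).trace.re = -(Real.log 2 * condEntropy ρ P) := by
  rw [hP.toIsProjFamily.trace_mul_cfc_sum_postState hρ, Complex.re_sum, condEntropy,
    Finset.mul_sum, ← Finset.sum_neg_distrib]
  refine Finset.sum_congr rfl fun i _ => ?_
  rw [Complex.smul_re, re_trace_mul_cfc_log (hP.isHermitian_postState hρ i), smul_eq_mul]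
  ring

lemma trace_onA_trB_mul_sum_postState :
    (onA B (trB ρ) * ∑ i, postState ρ (P i)).trace = ρ.trace := by
  have trace_eq (i : A) :
      (onA B (trB ρ) * postState ρ (P i)).trace = (ρ * onA B (P i)).trace := by
    have trace_mul : (trB ρ * P i).trace = outcomeProb ρ (P i) := by
      rw [← trace_mul_onA, Matrix.trace_mul_comm,
        trace_onA_mul hρ (hP.isHermitian i) (hP.mul_self i)]
    rw [hP.postState_eq, onA, ← Matrix.mul_kronecker_mul, one_mul, Matrix.trace_kronecker,
      Matrix.trace_smul, trace_outcomeBlock hρ (hP.isHermitian i) (hP.mul_self i), smul_eq_mul,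
      trace_mul_onA, trace_mul, ← mul_assoc, mul_inv_mul_cancel]
  rw [Finset.mul_sum, Matrix.trace_sum, Finset.sum_congr rfl fun i _ => trace_eq i,
    ← Matrix.trace_sum, ← Finset.mul_sum, hP.map_onA.complete, mul_one]

lemma log_two_mul_mutualI_sub_mutualJ :
    Real.log 2 * (mutualI ρ - mutualJ ρ P) =
      productRelEntropy ρ (onA B (trB ρ)) (∑ i, postState ρ (P i)) := by
  simp only [productRelEntropy, RCLike.re_eq_complex_re]
  rw [re_trace_mul_cfc_log hρ.isHermitian, re_trace_mul_cfc_log_onA_trB hρ,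
    hP.re_trace_mul_cfc_log_sum_postState hρ, mutualI_sub_mutualJ]
  ring

lemma posSemidef_sum_postState : (∑ i, postState ρ (P i)).PosSemidef :=
  Matrix.posSemidef_sum _ fun i _ => posSemidef_postState hρ (hP.isHermitian i) (hP.mul_self i)

lemma mutualI_sub_mutualJ_nonneg : 0 ≤ mutualI ρ - mutualJ ρ P := by
  refine nonneg_of_mul_nonneg_right ?_ (Real.log_pos one_lt_two)
  rw [hP.log_two_mul_mutualI_sub_mutualJ hρ]
  exact productRelEntropy_nonneg hρ (posSemidef_onA (posSemidef_trB hρ))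
    (hP.posSemidef_sum_postState hρ) (trace_mul_kerProj_onA_trB hρ)
    (hP.trace_mul_kerProj_sum_postState hρ) (hP.trace_onA_trB_mul_sum_postState hρ)

lemma exists_pinching_eq_self_of_mutualI_sub_mutualJ_eq_zero
    (h₀ : mutualI ρ - mutualJ ρ P = 0) :
    ∃ P' : A → Matrix A A ℂ, IsMeasurement P' ∧
      ρ = ∑ i, onA B (P' i) * ρ * onA B (P' i) := by
  obtain ⟨hcomm, hρ_eq⟩ := commute_and_eq_mul_of_productRelEntropy_eq_zero hρ
    (posSemidef_onA (posSemidef_trB hρ)) (hP.posSemidef_sum_postState hρ)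
    (trace_mul_kerProj_onA_trB hρ) (hP.trace_mul_kerProj_sum_postState hρ)
    (hP.trace_onA_trB_mul_sum_postState hρ)
    (by rw [← hP.log_two_mul_mutualI_sub_mutualJ hρ, h₀, mul_zero])
  simp only [hP.postState_eq] at hcomm hρ_eq
  obtain ⟨P', hP', hcomm'⟩ := hP.toIsProjFamily.exists_measurement_commute
    (posSemidef_trB hρ).isHermitian hcomm
  rw [← hρ_eq] at hcomm'
  exact ⟨P', hP', (hP'.map_onA.sum_mul_mul_self_of_commute hcomm').symm⟩

lemma condEntropy_eq :
    condEntropy ρ P = ∑ i, (entropy (onA B (P i) * ρ * onA B (P i)) +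
      outcomeProb ρ (P i) * Real.logb 2 (outcomeProb ρ (P i))) :=
  Finset.sum_congr rfl fun i _ =>
    outcomeProb_mul_entropy_postState hρ (hP.isHermitian i) (hP.mul_self i)

lemma trB_of_pinching_eq_self (h : ρ = ∑ i, onA B (P i) * ρ * onA B (P i)) :
    trB ρ = ∑ i, outcomeProb ρ (P i) • P i := by
  conv_lhs => rw [h, trB_sum]
  refine Finset.sum_congr rfl fun i _ => ?_
  rw [hP.onA_mul_mul_onA, trB_kronecker, trace_outcomeBlock hρ (hP.isHermitian i) (hP.mul_self i),
    Complex.coe_smul]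

lemma entropy_trB_of_pinching_eq_self (h : ρ = ∑ i, onA B (P i) * ρ * onA B (P i)) :
    entropy (trB ρ) = -∑ i, outcomeProb ρ (P i) * Real.logb 2 (outcomeProb ρ (P i)) := by
  rw [hP.trB_of_pinching_eq_self hρ h, entropy_sum_of_orthogonal, ← Finset.sum_neg_distrib]
  · refine Finset.sum_congr rfl fun i _ => ?_
    rw [entropy_smul (hP.isHermitian i),
      entropy_eq_zero_of_mul_self (hP.isHermitian i) (hP.mul_self i), hP.trace_eq_one]
    simp
  · exact fun i => (hP.isHermitian i).smul (IsSelfAdjoint.all _)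
  · intro i j hij
    rw [smul_mul_smul_comm, hP.orthogonal i j hij, smul_zero]

lemma mutualI_sub_mutualJ_eq_zero (h : ρ = ∑ i, onA B (P i) * ρ * onA B (P i)) :
    mutualI ρ - mutualJ ρ P = 0 := by
  have entropy_eq : entropy ρ = ∑ i, entropy (onA B (P i) * ρ * onA B (P i)) := by
    conv_lhs => rw [h]
    refine entropy_sum_of_orthogonal
      (fun i => (posSemidef_onA_mul_mul_onA hρ (hP.isHermitian i)).isHermitian) fun i j hij => ?_
    beta_reduce
    rw [hP.onA_mul_mul_onA, hP.onA_mul_mul_onA, ← Matrix.mul_kronecker_mul,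
      hP.orthogonal i j hij, Matrix.zero_kronecker]
  rw [mutualI_sub_mutualJ, hP.entropy_trB_of_pinching_eq_self hρ h, entropy_eq,
    hP.condEntropy_eq hρ, Finset.sum_add_distrib]
  ring

end Pos

end IsMeasurement

section Minimum

variable {ρ : Matrix (A × B) (A × B) ℂ}

lemma continuous_mul_logb (b : ℝ) : Continuous fun x : ℝ => x * Real.logb b x := by
  simp only [Real.logb, ← mul_div_assoc]
  exact Real.continuous_mul_log.div_const _

lemma continuousOn_condEntropy_basisMeasurement (hρ : ρ.PosSemidef) :
    ContinuousOn (fun V => condEntropy ρ (basisMeasurement V))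
      (Matrix.unitaryGroup A ℂ : Set (Matrix A A ℂ)) := by
  have continuous_onA_basis (i : A) :
      Continuous fun V : Matrix A A ℂ => onA B (basisMeasurement V i) :=
    continuous_onA.comp (continuous_basisMeasurement i)
  have continuous_prob (i : A) :
      Continuous fun V : Matrix A A ℂ => outcomeProb ρ (basisMeasurement V i) := by
    unfold outcomeProb
    fun_prop
  have continuous_entropy (i : A) : Continuous fun V : Matrix A A ℂ =>
      entropy (onA B (basisMeasurement V i) * ρ * onA B (basisMeasurement V i)) :=
    continuous_entropy_comp (by fun_prop) fun V =>
      (posSemidef_onA_mul_mul_onA hρ (Matrix.posSemidef_vecMulVec_self_star _).1).isHermitian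
  refine Continuous.continuousOn (f := fun V : Matrix A A ℂ => ∑ i, (_ + _))
    (continuous_finsetSum _ fun i _ => (continuous_entropy i).add
      ((continuous_mul_logb 2).comp (continuous_prob i))) |>.congr fun V hV => ?_
  exact (isMeasurement_basisMeasurement hV).condEntropy_eq hρ

lemma discordValues_eq_image (ρ : Matrix (A × B) (A × B) ℂ) :
    discordValues ρ = (fun V => mutualI ρ - mutualJ ρ (basisMeasurement V)) ''
      (Matrix.unitaryGroup A ℂ : Set (Matrix A A ℂ)) := by
  ext d
  constructor
  · rintro ⟨P, hP, rfl⟩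
    obtain ⟨V, hV, rfl⟩ := hP.exists_unitary
    exact ⟨V, hV, rfl⟩
  · rintro ⟨V, hV, rfl⟩
    exact ⟨basisMeasurement V, isMeasurement_basisMeasurement hV, rfl⟩

lemma isLeast_discordBA (hρ : ρ.PosSemidef) : IsLeast (discordValues ρ) (discordBA ρ) := by
  rw [discordBA, discordValues_eq_image]
  refine (isCompact_unitaryGroup.image_of_continuousOn ?_).isLeast_sInf
    (Set.Nonempty.image _ ⟨1, one_mem _⟩)
  simp only [mutualI_sub_mutualJ]
  exact continuousOn_const.add (continuousOn_condEntropy_basisMeasurement hρ)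

lemma discordBA_eq_zero_iff (hρ : ρ.PosSemidef) :
    discordBA ρ = 0 ↔ ∃ P : A → Matrix A A ℂ, IsMeasurement P ∧
      ρ = ∑ i, onA B (P i) * ρ * onA B (P i) := by
  have isLeast := isLeast_discordBA hρ
  constructor
  · intro h₀
    obtain ⟨P, hP, hd⟩ := isLeast.1
    exact hP.exists_pinching_eq_self_of_mutualI_sub_mutualJ_eq_zero hρ (hd.symm.trans h₀)
  · rintro ⟨P, hP, h⟩
    refine isLeast.unique ⟨⟨P, hP, (hP.mutualI_sub_mutualJ_eq_zero hρ h).symm⟩, ?_⟩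
    rintro _ ⟨P', hP', rfl⟩
    exact hP'.mutualI_sub_mutualJ_nonneg hρ

end Minimum

section ClassicalQuantum

lemma IsMeasurement.exists_cqMatrix_of_pinching_eq_self {P : A → Matrix A A ℂ}
    (hP : IsMeasurement P) {ρ : Matrix (A × B) (A × B) ℂ} (hρ : IsState ρ)
    (h : ρ = ∑ i, onA B (P i) * ρ * onA B (P i)) :
    ∃ (p : A → ℝ) (τ : A → Matrix B B ℂ), (∀ j, 0 ≤ p j) ∧ ∑ j, p j = 1 ∧
      (∀ j, IsState (τ j)) ∧ ρ = cqMatrix p P τ := by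
  have : Nonempty B := (nonempty_prod.1 (nonempty_of_isState hρ)).2
  choose τ hτ hblock using fun i =>
    exists_isState_eq_trace_smul (posSemidef_outcomeBlock hρ.posSemidef (hP.isHermitian i))
  refine ⟨fun i => outcomeProb ρ (P i), τ,
    fun i => outcomeProb_nonneg hρ.posSemidef (hP.isHermitian i) (hP.mul_self i), ?_, hτ, ?_⟩
  · rw [hP.sum_outcomeProb, hρ.trace_eq_one, Complex.one_re]
  · conv_lhs => rw [h]
    refine Finset.sum_congr rfl fun i _ => ?_
    rw [hP.onA_mul_mul_onA, hblock i, Matrix.kronecker_smul,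
      trace_outcomeBlock hρ.posSemidef (hP.isHermitian i) (hP.mul_self i)]

lemma IsProjFamily.exists_pinching_cqMatrix_eq_self {P : ι → Matrix A A ℂ} (hP : IsProjFamily P)
    (p : ι → ℝ) (τ : ι → Matrix B B ℂ) :
    ∃ P' : A → Matrix A A ℂ, IsMeasurement P' ∧
      cqMatrix p P τ = ∑ i, onA B (P' i) * cqMatrix p P τ * onA B (P' i) := by
  obtain ⟨P', hP', hcomm⟩ := hP.exists_measurement_commute (τ := fun i => (p i : ℂ) • τ i)
    Matrix.isHermitian_one (by rw [onA_one]; exact Commute.one_left _)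
  simp only [onA_one, one_mul, Matrix.kronecker_smul] at hcomm
  exact ⟨P', hP', (hP'.map_onA.sum_mul_mul_self_of_commute hcomm).symm⟩

end ClassicalQuantum

end Discord

section CompletePositivity

variable {A κ : Type*} [Fintype A] [DecidableEq A] [Fintype κ]

lemma ampliation_krausMap {C : Type*} [Fintype C] [DecidableEq C] (K : κ → Matrix A A ℂ)
    (X : Matrix (C × A) (C × A) ℂ) :
    ampliation C (krausMap K) X = ∑ k, (1 ⊗ₖ K k) * X * (1 ⊗ₖ K k)ᴴ := by
  ext ⟨c, a⟩ ⟨c', a'⟩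
  simp [ampliation, krausMap, Matrix.sum_apply, Matrix.mul_apply, Fintype.sum_prod_type,
    Matrix.one_apply, Finset.sum_mul, apply_ite (starRingEnd ℂ)]

lemma trace_krausMap {K : κ → Matrix A A ℂ} (hK : ∑ k, (K k)ᴴ * K k = 1)
    (X : Matrix A A ℂ) : (krausMap K X).trace = X.trace := by
  calc (∑ k, K k * X * (K k)ᴴ).trace = ∑ k, ((K k)ᴴ * K k * X).trace := by
        rw [Matrix.trace_sum]
        exact Finset.sum_congr rfl fun k _ => Matrix.trace_mul_cycle _ _ _
    _ = X.trace := by rw [← Matrix.trace_sum, ← Finset.sum_mul, hK, one_mul]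

lemma isCPTP_krausMap {K : κ → Matrix A A ℂ} (hK : ∑ k, (K k)ᴴ * K k = 1) :
    IsCPTP (krausMap K) where
  trace_preserving := trace_krausMap hK
  positive X hX := Matrix.posSemidef_sum _ fun k _ => hX.mul_mul_conjTranspose_same (K k)
  completely_positive m X hX := by
    rw [ampliation_krausMap]
    exact Matrix.posSemidef_sum _ fun k _ => hX.mul_mul_conjTranspose_same _

end CompletePositivity

section Basis

lemma kronecker_sum {A B ι : Type*} (s : Finset ι) (M : Matrix A A ℂ) (N : ι → Matrix B B ℂ) :
    M ⊗ₖ ∑ i ∈ s, N i = ∑ i ∈ s, M ⊗ₖ N i :=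
  map_sum (Matrix.kroneckerBilinear (R := ℂ) (α := ℂ) M) N s

variable {B : Type*} [Fintype B] (e : OrthonormalBasis B ℂ (EuclideanSpace ℂ B))

lemma sum_vecMulVec_star_orthonormalBasis [DecidableEq B] :
    ∑ n, Matrix.vecMulVec (e n) (star (e n).ofLp) = 1 := by
  let E : Matrix B B ℂ := (Matrix.of fun n => (e n).ofLp)ᵀ
  have hE : Eᴴ * E = 1 := by
    ext i j
    rw [Matrix.mul_apply, Matrix.one_apply, ← orthonormal_iff_ite.1 e.orthonormal i j,
      PiLp.inner_apply]
    exact Finset.sum_congr rfl fun k _ => mul_comm _ _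
  rw [← mul_eq_one_comm.1 hE]
  ext x y
  simp [E, Matrix.sum_apply, Matrix.mul_apply, Matrix.vecMulVec_apply]

lemma sum_vecMulVec_mulVec_orthonormalBasis {S : Matrix B B ℂ} (hS : IsSelfAdjoint S) :
    ∑ m, Matrix.vecMulVec (S *ᵥ e m) (star (S *ᵥ e m)) = S * S := by
  classical
  simp only [Matrix.star_mulVec, ← Matrix.mul_vecMulVec, ← Matrix.vecMulVec_mul]
  rw [← Matrix.sum_mul, ← Matrix.mul_sum, sum_vecMulVec_star_orthonormalBasis, mul_one,
    ← Matrix.star_eq_conjTranspose, hS.star_eq]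

end Basis

section BraKet

variable {A B : Type*} [DecidableEq A]

lemma conjTranspose_braB (v : B → ℂ) : (braB A v)ᴴ = ketB A v :=
  Matrix.conjTranspose_conjTranspose _

lemma conjTranspose_ketB (v : B → ℂ) : (ketB A v)ᴴ = braB A v := rfl

variable [Fintype A]

lemma ketB_mul_mul_braB (X : Matrix A A ℂ) (v w : B → ℂ) :
    ketB A v * X * braB A w = X ⊗ₖ Matrix.vecMulVec v (star w) := by
  ext x y
  simp only [ketB, braB, Matrix.mul_apply, Matrix.of_apply, Matrix.conjTranspose_apply,
    Matrix.kroneckerMap_apply, Matrix.vecMulVec_apply, Pi.star_apply, apply_ite star, star_zero,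
    ite_mul, zero_mul, mul_ite, mul_zero, Finset.sum_ite_eq, Finset.mem_univ, if_true]
  ring

variable [Fintype B]

lemma braB_mul_ketB (v w : B → ℂ) :
    braB A v * ketB A w = (w ⬝ᵥ star v) • (1 : Matrix A A ℂ) := by
  ext a b
  rcases eq_or_ne a b with rfl | h
  · simp [ketB, braB, Matrix.mul_apply, Fintype.sum_prod_type, dotProduct, mul_comm]
  · simp [ketB, braB, Matrix.mul_apply, Fintype.sum_prod_type, h, h.symm]

lemma braB_mul_mul_ketB_apply (v : B → ℂ) (Y : Matrix (A × B) (A × B) ℂ) (a a' : A) :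
    (braB A v * Y * ketB A v) a a' =
      ∑ x, ∑ y, Y (a, x) (a', y) * Matrix.vecMulVec v (star v) y x := by
  simp only [ketB, braB, Matrix.mul_apply, Fintype.sum_prod_type, Matrix.conjTranspose_apply,
    Matrix.of_apply, Finset.sum_mul, apply_ite star, star_zero, ite_mul, zero_mul, mul_ite,
    mul_zero, Finset.sum_ite_irrel, Finset.sum_const_zero, Finset.sum_ite_eq', Finset.mem_univ,
    if_true, Matrix.vecMulVec_apply, Pi.star_apply]
  rw [Finset.sum_comm]
  exact Finset.sum_congr rfl fun x _ => Finset.sum_congr rfl fun y _ => by ring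

variable (e : OrthonormalBasis B ℂ (EuclideanSpace ℂ B))

lemma sum_ketB_mul_braB [DecidableEq B] : ∑ n, ketB A (e n) * braB A (e n) = 1 := by
  calc ∑ n, ketB A (e n) * braB A (e n)
      = ∑ n, (1 : Matrix A A ℂ) ⊗ₖ Matrix.vecMulVec (e n) (star (e n).ofLp) :=
        Finset.sum_congr rfl fun n _ => by rw [← ketB_mul_mul_braB, Matrix.mul_one]
    _ = 1 := by
        rw [← kronecker_sum, sum_vecMulVec_star_orthonormalBasis, Matrix.one_kronecker_one]

lemma sum_braB_mul_mul_ketB (Y : Matrix (A × B) (A × B) ℂ) :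
    ∑ n, braB A (e n) * Y * ketB A (e n) = trB Y := by
  classical
  ext a a'
  simp only [Matrix.sum_apply, braB_mul_mul_ketB_apply]
  rw [Finset.sum_comm]
  refine Finset.sum_congr rfl fun x _ => ?_
  rw [Finset.sum_comm]
  simp only [← Finset.mul_sum]
  simp only [← Matrix.sum_apply, sum_vecMulVec_star_orthonormalBasis, Matrix.one_apply, mul_ite,
    mul_one, mul_zero, Finset.sum_ite_eq', Finset.mem_univ, if_true]

end BraKet

section Kraus

lemma trB_cqMatrix {A B ι : Type*} [Fintype B] [Fintype ι] (q : ι → ℝ) (P : ι → Matrix A A ℂ)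
    {τ : ι → Matrix B B ℂ} (hτ : ∀ j, IsState (τ j)) :
    trB (cqMatrix q P τ) = ∑ j, (q j : ℂ) • P j := by
  simp only [cqMatrix, trB_sum, ← Matrix.kronecker_smul, trB_kronecker, Matrix.trace_smul,
    (hτ _).trace_eq_one, smul_eq_mul, mul_one]

variable {A B ι : Type*} [Fintype A] [DecidableEq A] [Fintype B] [DecidableEq B] [Fintype ι]

/-- The operator `∑ l, (√τ_l |v⟩)^B Π_l`, which appends to a state of `A` in the range of `Π_l` the
unnormalized state `√τ_l |v⟩` of `B`; a Kraus operator of the reduced evolution is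
`⟨n|^B U W` for such an operator `W`. -/
noncomputable def preparation (P : ι → Matrix A A ℂ) (τ : ι → Matrix B B ℂ) (v : B → ℂ) :
    Matrix (A × B) A ℂ :=
  ∑ l, ketB A (CFC.sqrt (τ l) *ᵥ v) * P l

lemma krausOp_eq (P : ι → Matrix A A ℂ) (τ : ι → Matrix B B ℂ) (U : Matrix (A × B) (A × B) ℂ)
    (e : OrthonormalBasis B ℂ (EuclideanSpace ℂ B)) (n m : B) :
    krausOp P τ U e (n, m) = braB A (e n) * (U * preparation P τ (e m)) := by
  simp only [krausOp, preparation, Matrix.mul_sum, Matrix.mul_assoc]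

section Preparation

variable {P : ι → Matrix A A ℂ} (hP : IsProjFamily P) (τ : ι → Matrix B B ℂ)
include hP

lemma preparation_mul (v : B → ℂ) (j : ι) :
    preparation P τ v * P j = ketB A (CFC.sqrt (τ j) *ᵥ v) * P j := by
  classical
  rw [preparation, Matrix.sum_mul, Finset.sum_eq_single_of_mem j (Finset.mem_univ j)]
  · rw [Matrix.mul_assoc, hP.mul_self]
  · intro k _ hk
    rw [Matrix.mul_assoc, hP.orthogonal k j hk, Matrix.mul_zero]

lemma mul_conjTranspose_preparation (v : B → ℂ) (j : ι) :
    P j * (preparation P τ v)ᴴ = P j * braB A (CFC.sqrt (τ j) *ᵥ v) := by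
  have h := congrArg Matrix.conjTranspose (preparation_mul hP τ v j)
  rwa [Matrix.conjTranspose_mul, Matrix.conjTranspose_mul, (hP.isHermitian j).eq,
    conjTranspose_ketB] at h

lemma conjTranspose_preparation_mul_preparation (v : B → ℂ) :
    (preparation P τ v)ᴴ * preparation P τ v =
      ∑ l, (Matrix.vecMulVec (CFC.sqrt (τ l) *ᵥ v) (star (CFC.sqrt (τ l) *ᵥ v))).trace • P l := by
  classical
  have summand_mul (l k : ι) : (ketB A (CFC.sqrt (τ l) *ᵥ v) * P l)ᴴ *
      (ketB A (CFC.sqrt (τ k) *ᵥ v) * P k) =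
        ((CFC.sqrt (τ k) *ᵥ v) ⬝ᵥ star (CFC.sqrt (τ l) *ᵥ v)) • (P l * P k) := by
    rw [Matrix.conjTranspose_mul, (hP.isHermitian l).eq, conjTranspose_ketB, Matrix.mul_assoc,
      ← Matrix.mul_assoc (braB A _), braB_mul_ketB, smul_mul_assoc, one_mul, mul_smul_comm]
  rw [preparation, Matrix.conjTranspose_sum, Matrix.sum_mul]
  refine Finset.sum_congr rfl fun l _ => ?_
  rw [Matrix.mul_sum, Finset.sum_eq_single_of_mem l (Finset.mem_univ l)]
  · rw [summand_mul, hP.mul_self, Matrix.trace_vecMulVec]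
  · intro k _ hk
    rw [summand_mul, hP.orthogonal l k hk.symm, smul_zero]

variable {τ} (hτ : ∀ j, IsState (τ j)) (e : OrthonormalBasis B ℂ (EuclideanSpace ℂ B))
include hτ

lemma sum_conjTranspose_preparation_mul_preparation :
    ∑ m, (preparation P τ (e m))ᴴ * preparation P τ (e m) = 1 := by
  simp only [conjTranspose_preparation_mul_preparation hP]
  rw [Finset.sum_comm, ← hP.complete]
  refine Finset.sum_congr rfl fun l _ => ?_
  rw [← Finset.sum_smul, ← Matrix.trace_sum,
    sum_vecMulVec_mulVec_orthonormalBasis e (CFC.sqrt_nonneg (τ l)).isSelfAdjoint,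
    CFC.sqrt_mul_sqrt_self (τ l) (hτ l).posSemidef.nonneg, (hτ l).trace_eq_one, one_smul]

lemma sum_preparation_mul_mul_conjTranspose (j : ι) :
    ∑ m, preparation P τ (e m) * P j * (preparation P τ (e m))ᴴ = P j ⊗ₖ τ j := by
  simp only [preparation_mul hP, Matrix.mul_assoc, mul_conjTranspose_preparation hP]
  simp only [← Matrix.mul_assoc, ketB_mul_mul_braB]
  rw [← kronecker_sum,
    sum_vecMulVec_mulVec_orthonormalBasis e (CFC.sqrt_nonneg (τ j)).isSelfAdjoint,
    CFC.sqrt_mul_sqrt_self (τ j) (hτ j).posSemidef.nonneg]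

lemma cqMatrix_eq_sum_preparation (q : ι → ℝ) :
    cqMatrix q P τ = ∑ m, preparation P τ (e m) * trB (cqMatrix q P τ) *
      (preparation P τ (e m))ᴴ := by
  simp only [trB_cqMatrix q P hτ, Matrix.mul_sum, Matrix.sum_mul, Matrix.mul_smul,
    Matrix.smul_mul]
  rw [Finset.sum_comm]
  simp only [← Finset.smul_sum, sum_preparation_mul_mul_conjTranspose hP hτ e]
  rfl

lemma sum_conjTranspose_krausOp_mul_krausOp {U : Matrix (A × B) (A × B) ℂ}
    (hU : U ∈ Matrix.unitaryGroup (A × B) ℂ) :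
    ∑ α, (krausOp P τ U e α)ᴴ * krausOp P τ U e α = 1 := by
  rw [Fintype.sum_prod_type_right, ← sum_conjTranspose_preparation_mul_preparation hP hτ e]
  refine Finset.sum_congr rfl fun m _ => ?_
  let W := preparation P τ (e m)
  calc ∑ n, (krausOp P τ U e (n, m))ᴴ * krausOp P τ U e (n, m)
      = ∑ n, (U * W)ᴴ * (ketB A (e n) * braB A (e n)) * (U * W) :=
        Finset.sum_congr rfl fun n _ => by
          simp only [krausOp_eq, Matrix.conjTranspose_mul, conjTranspose_braB, Matrix.mul_assoc, W]
    _ = (U * W)ᴴ * (U * W) := by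
        rw [← Matrix.sum_mul, ← Matrix.mul_sum, sum_ketB_mul_braB, Matrix.mul_one]
    _ = Wᴴ * (Uᴴ * U) * W := by simp only [Matrix.conjTranspose_mul, Matrix.mul_assoc]
    _ = Wᴴ * W := by
        rw [← Matrix.star_eq_conjTranspose U, Matrix.mem_unitaryGroup_iff'.1 hU, Matrix.mul_one]

lemma reducedEvolution_cqMatrix (U : Matrix (A × B) (A × B) ℂ) (q : ι → ℝ) :
    reducedEvolution U (cqMatrix q P τ) =
      ∑ α, krausOp P τ U e α * trB (cqMatrix q P τ) * (krausOp P τ U e α)ᴴ := by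
  let W := fun m => preparation P τ (e m)
  have conj_eq : U * cqMatrix q P τ * Uᴴ =
      ∑ m, U * W m * trB (cqMatrix q P τ) * (U * W m)ᴴ := by
    conv_lhs => rw [cqMatrix_eq_sum_preparation hP hτ e q]
    simp only [Matrix.mul_sum, Matrix.sum_mul, Matrix.conjTranspose_mul, Matrix.mul_assoc, W]
  rw [reducedEvolution, conj_eq, ← sum_braB_mul_mul_ketB e, Fintype.sum_prod_type]
  simp only [krausOp_eq, Matrix.mul_sum, Matrix.sum_mul, Matrix.conjTranspose_mul,
    conjTranspose_braB, Matrix.mul_assoc, W]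

end Preparation

end Kraus

section Reindexing

variable {A B ι κ : Type*} [Fintype ι] [Fintype κ]

lemma IsProjFamily.comp_equiv [Fintype A] [DecidableEq A] {P : ι → Matrix A A ℂ}
    (hP : IsProjFamily P) (E : κ ≃ ι) : IsProjFamily (P ∘ E) where
  isHermitian i := hP.isHermitian (E i)
  mul_self i := hP.mul_self (E i)
  orthogonal i j hij := hP.orthogonal (E i) (E j) (E.injective.ne hij)
  complete := (E.sum_comp P).trans hP.complete

lemma cqMatrix_comp_equiv (p : ι → ℝ) (P : ι → Matrix A A ℂ) (τ : ι → Matrix B B ℂ)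
    (E : κ ≃ ι) : cqMatrix (p ∘ E) (P ∘ E) (τ ∘ E) = cqMatrix p P τ :=
  E.sum_comp fun j => (p j : ℂ) • (P j ⊗ₖ τ j)

end Reindexing

end QDiscord

open QDiscord in
/-- Zero discord (with measurements on the system `A`), its equivalent forms, and complete
positivity of the reduced evolution of every state of zero discord. The first part says that the
minimum defining the discord is attained. In the last part the operators do not depend on the
weights `p`, so that one and the same CPTP map describes the evolution of all the states with the
same projectors and the same `τ`. -/
theorem mainTheorem1 {A B : Type*} [Fintype A] [DecidableEq A] [Fintype B] [DecidableEq B]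
    (ρ : Matrix (A × B) (A × B) ℂ) (hρ : IsState ρ) :
    IsLeast (discordValues ρ) (discordBA ρ) ∧
    List.TFAE [
      discordBA ρ = 0,
      ∃ P : A → Matrix A A ℂ, IsMeasurement P ∧ ρ = ∑ i, onA B (P i) * ρ * onA B (P i),
      ∃ (P : A → Matrix A A ℂ) (p : A → ℝ) (τ : A → Matrix B B ℂ),
        IsMeasurement P ∧ (∀ j, 0 ≤ p j) ∧ ∑ j, p j = 1 ∧ (∀ j, IsState (τ j)) ∧
          ρ = cqMatrix p P τ,
      ∃ (k : ℕ) (P : Fin k → Matrix A A ℂ) (p : Fin k → ℝ) (τ : Fin k → Matrix B B ℂ),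
        IsProjFamily P ∧ (∀ j, 0 ≤ p j) ∧ (∀ j, IsState (τ j)) ∧ ρ = cqMatrix p P τ] ∧
    ∀ (ι : Type*) [Fintype ι] (P : ι → Matrix A A ℂ) (p : ι → ℝ) (τ : ι → Matrix B B ℂ),
      IsProjFamily P → (∀ j, 0 ≤ p j) → (∀ j, IsState (τ j)) → ρ = cqMatrix p P τ →
      ∀ U ∈ Matrix.unitaryGroup (A × B) ℂ,
      ∀ e : OrthonormalBasis B ℂ (EuclideanSpace ℂ B),
        (∑ α, (krausOp P τ U e α)ᴴ * krausOp P τ U e α = 1) ∧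
        IsCPTP (krausMap (krausOp P τ U e)) ∧
        reducedEvolution U ρ =
          ∑ α, krausOp P τ U e α * trB ρ * (krausOp P τ U e α)ᴴ ∧
        ∀ q : ι → ℝ, IsState (cqMatrix q P τ) →
          reducedEvolution U (cqMatrix q P τ) =
            krausMap (krausOp P τ U e) (trB (cqMatrix q P τ)) := by
  refine ⟨isLeast_discordBA hρ.posSemidef, ?_, ?_⟩
  · tfae_have 1 ↔ 2 := discordBA_eq_zero_iff hρ.posSemidef
    tfae_have 2 → 3 := fun ⟨P, hP, h⟩ =>
      have ⟨p, τ, hcq⟩ := hP.exists_cqMatrix_of_pinching_eq_self hρ h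
      ⟨P, p, τ, hP, hcq⟩
    tfae_have 3 → 4 := fun ⟨P, p, τ, hP, hp, _, hτ, h⟩ =>
      let E := (Fintype.equivFin A).symm
      ⟨_, P ∘ E, p ∘ E, τ ∘ E, hP.comp_equiv E, fun j => hp (E j), fun j => hτ (E j),
        h.trans (cqMatrix_comp_equiv p P τ E).symm⟩
    tfae_have 4 → 2 := fun ⟨_, P, p, τ, hP, _, _, h⟩ =>
      h ▸ hP.exists_pinching_cqMatrix_eq_self p τ
    tfae_finish
  · rintro ι _ P p τ hP - hτ rfl U hU e
    have complete := sum_conjTranspose_krausOp_mul_krausOp hP hτ e hU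
    exact ⟨complete, isCPTP_krausMap complete, reducedEvolution_cqMatrix hP hτ e U p,
      fun q _ => reducedEvolution_cqMatrix hP hτ e U q⟩
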